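/- Let $G_1,\dots,G_m$ be finite groups with identities $e_k$, let $S_k\subseteq G_k\setminus\{e_k\}$ generate $G_k$, let $G=G_1*\cdots*G_m$ be the free product with identity $e$, and let $|x|$ be the word length of $x\in G$, i.e. the graph distance from $e$ to $x$ in the (undirected) Cayley graph of $G$ with respect to $S=\bigcup_k S_k$. Let $\mu_k$ be a probability measure on $G_k$ for each $k$, let $\alpha_1,\dots,\alpha_m>0$ with $\sum_k\alpha_k=1$, and put $\mu=\sum_k\alpha_k\mu_k$, a probability measure on $G$. Let $\pi$ be a probability distribution on $\{0,1,2,\dots\}$ with $\pi(0)=0$ and mean $\rho=\sum_k k\,\pi(k)$ satisfying $1<\rho<\infty$. Let $(Y_n)_{n\ge 0}$ be the random walk on $G$ with $Y_0=e$ and transition probabilities $p(x,y)=\mu(x^{-1}y)$, and define $$\Lambda(t)=\lim_{n\to\infty}\frac1n\log\mathbb E\big[e^{t|Y_n|}\big]\ (t\in\mathbb R),\qquad I(x)=\sup_{t\in\mathbb R}\{xt-\Lambda(t)\}\in[-\infty,\infty]\ (x\in\mathbb R),$$ $$r=\limsup_{n\to\infty}\mathbb P(Y_n=e)^{1/n},\qquad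 v_{\min}=\begin{cases}\inf\{x\in\mathbb R: I(x)=\log\rho\}, & \log\rho\le-\log r,\\ 0,&\log\rho>-\log r.\end{cases}$$ Let $\mathbb T$ be the Galton–Watson tree with offspring distribution $\pi$ (root $\emptyset$; a vertex $v$ has children $v1,\dots,v\xi_v$, with $\xi_v$ i.i.d. of law $\pi$), write $|v|$ for the generation of a vertex $v$, and let $(X_v)_{v\in\mathbb T}$ be the branching random walk $X_\emptyset=e$, $X_v=\zeta_{v_1}\zeta_{v_2}\cdots\zeta_{v}$, where $v_k$ is the ancestor of $v$ in generation $k$ and the steps $\zeta_v$ are i.i.d. of law $\mu$, independent of $\mathbb T$. Then $$\lim_{n\to\infty}\frac{\min_{|v|=n}|X_v|}{n}=v_{\min}\qquad\text{almost surely}.$$ -/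

import Mathlib

open MeasureTheory ProbabilityTheory Filter Topology
open scoped ENNReal

namespace FreeProductBRW

/-! ### Word length and random walk on a group -/

section Walk

variable {H : Type*} [Group H]

/-- The word length of `x`: the graph distance from the identity to `x` in the (undirected) Cayley
graph of `H` with respect to `S`. -/
noncomputable def wordLength (S : Set H) (x : H) : ℕ :=
  (SimpleGraph.mulCayley S).dist 1 x

/-- The law of `Y n`, where `Y` is the random walk on `H` started at the identity with one-step
transition probabilities `p(x, y) = μ (x⁻¹ * y)`. -/
noncomputable def walkLaw (μ : PMF H) : ℕ → PMF H
  | 0 => PMF.pure 1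
  | n + 1 => (walkLaw μ n).bind fun x => μ.map fun g => x * g

/-- The spectral radius `limsup P(Y n = e) ^ (1 / n)`. -/
noncomputable def spectralRadius (μ : PMF H) : ℝ :=
  limsup (fun n : ℕ => (walkLaw μ n 1).toReal ^ (1 / (n : ℝ))) atTop

variable [MeasurableSpace H]

/-- `Λ n t = (1 / n) * log E[exp (t * |Y n|)]`. -/
noncomputable def logMGF (S : Set H) (μ : PMF H) (n : ℕ) (t : ℝ) : ℝ :=
  1 / (n : ℝ) * Real.log (∫ x, Real.exp (t * (wordLength S x : ℝ)) ∂(walkLaw μ n).toMeasure)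

/-- `Λ t = lim Λ n t` as `n → ∞`. -/
noncomputable def limitLogMGF (S : Set H) (μ : PMF H) (t : ℝ) : ℝ :=
  limUnder atTop fun n : ℕ => logMGF S μ n t

/-- The rate function `I x = sup_t (x * t - Λ t)`, with values in `[-∞, ∞]`. -/
noncomputable def rateFunction (S : Set H) (μ : PMF H) (x : ℝ) : EReal :=
  ⨆ t : ℝ, ((x * t - limitLogMGF S μ t : ℝ) : EReal)

open Classical in
/-- The speed `v_min`, for offspring mean `ρ`. -/
noncomputable def vMin (S : Set H) (μ : PMF H) (ρ : ℝ) : ℝ :=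
  if Real.log ρ ≤ -Real.log (spectralRadius μ) then
    sInf {x : ℝ | rateFunction S μ x = (Real.log ρ : EReal)}
  else 0

end Walk

/-! ### Free products -/

section FreeProduct

variable {m : ℕ} {G : Fin m → Type*} [∀ i, Group (G i)]

/-- All subsets of the (countable, discrete) free product are measurable. -/
instance : MeasurableSpace (Monoid.CoprodI G) := ⊤

/-- The generating set `S = ⋃ k, S k` of the free product. -/
def generators (S : ∀ i, Set (G i)) : Set (Monoid.CoprodI G) :=
  ⋃ i, (Monoid.CoprodI.of : G i →* Monoid.CoprodI G) '' S i

/-- The step distribution `∑ i, α i * μ i` on the free product: first choose a factor `G i` with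
probability `α i`, then an element of `G i` according to `μ i`. -/
noncomputable def stepLaw (α : PMF (Fin m)) (μ : ∀ i, PMF (G i)) : PMF (Monoid.CoprodI G) :=
  α.bind fun i => (μ i).map (Monoid.CoprodI.of : G i →* Monoid.CoprodI G)

end FreeProduct

/-! ### Branching random walk -/

/-- The vertices of the Galton–Watson tree in which the word `v` has `ξ v` children, namely
`v1, …, v(ξ v)`. -/
inductive InTree (ξ : List ℕ → ℕ) : List ℕ → Prop
  | root : InTree ξ []
  | child (v : List ℕ) (k : ℕ) : InTree ξ v → 1 ≤ k → k ≤ ξ v → InTree ξ (v ++ [k])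

/-- The vertices of the tree at level `n`. -/
def level (ξ : List ℕ → ℕ) (n : ℕ) : Set (List ℕ) :=
  {v | InTree ξ v ∧ v.length = n}

/-- The position `ζ (v₁) * ζ (v₂) * ⋯ * ζ (v)` of the particle `v`, where `v_k` is the prefix of
`v` of length `k`. -/
def position {H : Type*} [Group H] (ζ : List ℕ → H) (v : List ℕ) : H :=
  ((List.range v.length).map fun k => ζ (v.take (k + 1))).prod

/-- The minimal displacement `min {|X v| : v ∈ T, |v| = n}`. -/
noncomputable def minDisplacement {H : Type*} [Group H] (S : Set H) (ξ : List ℕ → ℕ)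
    (ζ : List ℕ → H) (n : ℕ) : ℕ :=
  sInf ((fun v => wordLength S (position ζ v)) '' level ξ n)

/-- The offspring numbers `ξ v` are i.i.d. with law `π`, the steps `ζ v` are i.i.d. with law `μ`,
and the two families are independent of each other. -/
structure IsBranchingRandomWalk {H : Type*} [MeasurableSpace H] {Ω : Type*} [MeasurableSpace Ω]
    (P : Measure Ω) (π : PMF ℕ) (μ : PMF H) (ξ : List ℕ → Ω → ℕ) (ζ : List ℕ → Ω → H) : Prop where
  measurable_offspring : ∀ v, Measurable (ξ v)
  measurable_step : ∀ v, Measurable (ζ v)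
  law_offspring : ∀ v, P.map (ξ v) = π.toMeasure
  law_step : ∀ v, P.map (ζ v) = μ.toMeasure
  indep_offspring : iIndepFun ξ P
  indep_step : iIndepFun ζ P
  indep_offspring_step : IndepFun (fun ω v => ξ v ω) (fun ω v => ζ v ω) P

/-! ### Well-definedness of the word length and of the limit `Λ` -/

section WellDefined

variable {H : Type*} [Group H] {S : Set H}

/-- Left multiplication as a graph homomorphism of the Cayley graph. -/
def leftHom (S : Set H) (g : H) : SimpleGraph.mulCayley S →g SimpleGraph.mulCayley S where
  toFun x := g * x
  map_rel' {a b} h := by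
    rw [SimpleGraph.mulCayley_adj'] at h ⊢
    obtain ⟨hne, s, hs, h⟩ := h
    refine ⟨fun h => hne (mul_left_cancel h), s, hs, ?_⟩
    rcases h with h | h
    · left; rw [mul_assoc, h]
    · right; rw [mul_assoc, h]

theorem connected_mulCayley (hS : Subgroup.closure S = ⊤) :
    (SimpleGraph.mulCayley S).Connected := by
  have key : ∀ x : H, (SimpleGraph.mulCayley S).Reachable 1 x := by
    intro x
    have hx : x ∈ Subgroup.closure S := hS ▸ Subgroup.mem_top x
    induction hx using Subgroup.closure_induction with
    | mem y hy =>
      by_cases h : 1 = y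
      · rw [h]
      · exact SimpleGraph.Adj.reachable
          ((SimpleGraph.mulCayley_adj' S 1 y).2 ⟨h, y, hy, Or.inl (one_mul y)⟩)
    | one => exact SimpleGraph.Reachable.refl _
    | mul y z _ _ h1 h2 =>
      have := h2.map (leftHom S y)
      simp only [leftHom, RelHom.coeFn_mk, mul_one] at this
      exact h1.trans this
    | inv y _ h =>
      have := h.map (leftHom S y⁻¹)
      simp only [leftHom, RelHom.coeFn_mk, mul_one, inv_mul_cancel] at this
      exact this.symm
  have : Nonempty H := ⟨1⟩
  exact ⟨fun x y => (key x).symm.trans (key y)⟩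

theorem wordLength_mul_le (hS : Subgroup.closure S = ⊤) (x y : H) :
    wordLength S (x * y) ≤ wordLength S x + wordLength S y := by
  have hc := connected_mulCayley hS
  refine (hc.dist_triangle (v := x)).trans (Nat.add_le_add_left ?_ _)
  obtain ⟨p, hp⟩ := hc.exists_walk_length_eq_dist 1 y
  have := SimpleGraph.dist_le (p.map (leftHom S x))
  rw [SimpleGraph.Walk.length_map, hp] at this
  simpa [leftHom, wordLength] using this

theorem walkLaw_add (μ : PMF H) (a b : ℕ) :
    walkLaw μ (a + b) = (walkLaw μ a).bind fun x => (walkLaw μ b).map fun y => x * y := by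
  induction b with
  | zero => simp [walkLaw, PMF.pure_map]
  | succ b ih =>
    rw [← add_assoc, walkLaw, ih, walkLaw]
    simp only [PMF.bind_bind, PMF.map_bind, PMF.bind_map, PMF.map_comp, Function.comp_def, mul_assoc]

theorem tsum_walkLaw_add (μ : PMF H) (a b : ℕ) (w : H → ℝ≥0∞) :
    ∑' z, walkLaw μ (a + b) z * w z
      = ∑' x, walkLaw μ a x * ∑' y, walkLaw μ b y * w (x * y) := by
  have hbind : ∀ (p : PMF H) (f : H → PMF H) (w : H → ℝ≥0∞),
      ∑' z, p.bind f z * w z = ∑' x, p x * ∑' z, f x z * w z := fun p f w => by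
    simp only [PMF.bind_apply, ← ENNReal.tsum_mul_right, ← ENNReal.tsum_mul_left]
    rw [ENNReal.tsum_comm]
    simp only [mul_assoc]
  rw [walkLaw_add, hbind]
  refine tsum_congr fun x => ?_
  rw [← PMF.bind_pure_comp, hbind]
  simp

/-- The limit defining `Λ t` exists. -/
theorem tendsto_logMGF [Countable H] [MeasurableSpace H] [DiscreteMeasurableSpace H]
    (hS : Subgroup.closure S = ⊤) (μ : PMF H) (hμ : μ.support.Finite) (t : ℝ) :
    Tendsto (fun n => logMGF S μ n t) atTop (𝓝 (limitLogMGF S μ t)) := by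
  set w : H → ℝ≥0∞ := fun x => ENNReal.ofReal (Real.exp (t * wordLength S x)) with hw
  set F : ℕ → ℝ≥0∞ := fun n => ∑' x, walkLaw μ n x * w x with hF
  have hE : ∀ n, ∫ x, Real.exp (t * (wordLength S x : ℝ)) ∂(walkLaw μ n).toMeasure
      = (F n).toReal := fun n => by
    rw [integral_eq_lintegral_of_nonneg_ae (ae_of_all _ fun x => (Real.exp_pos _).le)
      (measurable_of_countable _).aestronglyMeasurable, lintegral_countable']
    simp only [PMF.toMeasure_apply_singleton _ _ (MeasurableSet.singleton _), hF, hw, mul_comm]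
  have hpos : ∀ n, F n ≠ 0 := fun n h => by
    obtain ⟨x, hx⟩ := (walkLaw μ n).support_nonempty
    have h1 := ENNReal.tsum_eq_zero.1 h x
    rcases mul_eq_zero.1 h1 with h2 | h2
    · exact hx h2
    · exact (ENNReal.ofReal_pos.2 (Real.exp_pos _)).ne' h2
  suffices h : ∃ l, Tendsto (fun n => logMGF S μ n t) atTop (𝓝 l) by
    rw [limitLogMGF]
    exact tendsto_nhds_limUnder h
  have hlog : ∀ n, logMGF S μ n t = Real.log (F n).toReal / n := fun n => by
    rw [logMGF, hE]; ring
  simp only [hlog]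
  rcases le_total 0 t with ht | ht
  · have hsub : ∀ a b, F (a + b) ≤ F a * F b := fun a b => by
      simp only [hF, tsum_walkLaw_add, ← ENNReal.tsum_mul_right]
      refine ENNReal.tsum_le_tsum fun x => ?_
      rw [mul_assoc, ← ENNReal.tsum_mul_left (a := w x)]
      refine mul_le_mul' le_rfl (ENNReal.tsum_le_tsum fun y => ?_)
      rw [mul_left_comm]
      refine mul_le_mul' le_rfl ?_
      simp only [hw]
      rw [← ENNReal.ofReal_mul (Real.exp_pos _).le, ← Real.exp_add, ← mul_add]
      gcongr
      exact_mod_cast wordLength_mul_le hS x y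
    have hfin : ∀ n, F n ≠ ⊤ := fun n => by
      induction n with
      | zero =>
        simp only [hF, walkLaw]
        rw [tsum_eq_single 1 fun z hz => by simp [hz]]
        simp [hw]
      | succ n ih =>
        refine ne_top_of_le_ne_top (ENNReal.mul_ne_top ih ?_) (hsub n 1)
        have h1 : walkLaw μ 1 = μ := by
          simp only [walkLaw, PMF.pure_bind, one_mul]
          exact PMF.map_id μ
        simp only [hF, h1]
        rw [tsum_eq_sum (s := hμ.toFinset) fun x hx => by
          rw [(PMF.apply_eq_zero_iff μ x).2 (by simpa using hx), zero_mul]]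
        exact ENNReal.sum_ne_top.2 fun x _ =>
          ENNReal.mul_ne_top (μ.apply_ne_top x) ENNReal.ofReal_ne_top
    have hone : ∀ n, 1 ≤ (F n).toReal := fun n => by
      rw [← ENNReal.toReal_one, ENNReal.toReal_le_toReal ENNReal.one_ne_top (hfin n),
        ← (walkLaw μ n).tsum_coe]
      refine ENNReal.tsum_le_tsum fun x => le_mul_of_one_le_right' ?_
      exact ENNReal.one_le_ofReal.2 (Real.one_le_exp (by positivity))
    have hs : Subadditive fun n => Real.log (F n).toReal := fun a b => by
      rw [← Real.log_mul (by linarith [hone a]) (by linarith [hone b]), ← ENNReal.toReal_mul]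
      exact Real.log_le_log (by linarith [hone (a + b)])
        (ENNReal.toReal_mono (ENNReal.mul_ne_top (hfin a) (hfin b)) (hsub a b))
    refine ⟨hs.lim, hs.tendsto_lim ⟨0, ?_⟩⟩
    rintro _ ⟨n, rfl⟩
    exact div_nonneg (Real.log_nonneg (hone n)) (Nat.cast_nonneg n)
  · have hsup : ∀ a b, F a * F b ≤ F (a + b) := fun a b => by
      simp only [hF, tsum_walkLaw_add, ← ENNReal.tsum_mul_right]
      refine ENNReal.tsum_le_tsum fun x => ?_
      rw [mul_assoc, ← ENNReal.tsum_mul_left (a := w x)]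
      refine mul_le_mul' le_rfl (ENNReal.tsum_le_tsum fun y => ?_)
      rw [mul_left_comm]
      refine mul_le_mul' le_rfl ?_
      simp only [hw]
      rw [← ENNReal.ofReal_mul (Real.exp_pos _).le, ← Real.exp_add, ← mul_add]
      refine ENNReal.ofReal_le_ofReal (Real.exp_le_exp.2 (mul_le_mul_of_nonpos_left ?_ ht))
      exact_mod_cast wordLength_mul_le hS x y
    have hle : ∀ n, F n ≤ 1 := fun n => by
      rw [← (walkLaw μ n).tsum_coe]
      refine ENNReal.tsum_le_tsum fun x => mul_le_of_le_one_right' ?_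
      rw [hw, ENNReal.ofReal_le_one, Real.exp_le_one_iff]
      exact mul_nonpos_of_nonpos_of_nonneg ht (Nat.cast_nonneg _)
    have hfin : ∀ n, F n ≠ ⊤ := fun n => ne_top_of_le_ne_top ENNReal.one_ne_top (hle n)
    have hp : ∀ n, 0 < (F n).toReal := fun n => ENNReal.toReal_pos (hpos n) (hfin n)
    have hs : Subadditive fun n => -Real.log (F n).toReal := fun a b => by
      rw [← neg_add, neg_le_neg_iff, ← Real.log_mul (hp a).ne' (hp b).ne', ← ENNReal.toReal_mul]
      exact Real.log_le_log (by rw [ENNReal.toReal_mul]; exact mul_pos (hp a) (hp b))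
        (ENNReal.toReal_mono (hfin _) (hsup a b))
    have hlim := hs.tendsto_lim ⟨0, by
      rintro _ ⟨n, rfl⟩
      refine div_nonneg (neg_nonneg.2 (Real.log_nonpos (hp n).le ?_)) (Nat.cast_nonneg n)
      exact ENNReal.toReal_mono ENNReal.one_ne_top (hle n)⟩
    exact ⟨_, by simpa only [neg_div, neg_neg] using hlim.neg⟩

end WellDefined

section WellDefinedFreeProduct

variable {m : ℕ} {G : Fin m → Type*} [∀ i, Group (G i)]

instance : DiscreteMeasurableSpace (Monoid.CoprodI G) := ⟨fun _ => trivial⟩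

instance [∀ i, Finite (G i)] : Countable (Monoid.CoprodI G) := by
  have : Countable (FreeMonoid (Σ i, G i)) := inferInstanceAs (Countable (List (Σ i, G i)))
  exact Quotient.countable

theorem closure_generators {S : ∀ i, Set (G i)}
    (hS : ∀ i, Subgroup.closure (S i) = ⊤) : Subgroup.closure (generators S) = ⊤ := by
  rw [generators, Subgroup.closure_iUnion]
  have h : ∀ i, Subgroup.closure ((Monoid.CoprodI.of : G i →* Monoid.CoprodI G) '' S i)
      = (Monoid.CoprodI.of : G i →* Monoid.CoprodI G).range := fun i => by
    rw [← MonoidHom.map_closure, hS, MonoidHom.range_eq_map]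
  simp only [h]
  rw [← Monoid.CoprodI.range_eq_iSup, Monoid.CoprodI.lift_of']
  exact MonoidHom.range_eq_top.2 Function.surjective_id

theorem finite_support_stepLaw [∀ i, Finite (G i)] (α : PMF (Fin m)) (μ : ∀ i, PMF (G i)) :
    (stepLaw α μ).support.Finite := by
  rw [stepLaw, PMF.support_bind]
  refine Set.Finite.biUnion (Set.toFinite _) fun i _ => ?_
  rw [PMF.support_map]
  exact (Set.toFinite _).image _

theorem tendsto_logMGF_stepLaw [∀ i, Finite (G i)] (α : PMF (Fin m)) (μ : ∀ i, PMF (G i))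
    {S : ∀ i, Set (G i)} (hS : ∀ i, Subgroup.closure (S i) = ⊤) (t : ℝ) :
    Tendsto (fun n => logMGF (generators S) (stepLaw α μ) n t) atTop
      (𝓝 (limitLogMGF (generators S) (stepLaw α μ) t)) :=
  tendsto_logMGF (closure_generators hS) (stepLaw α μ) (finite_support_stepLaw α μ) t

end WellDefinedFreeProduct

end FreeProductBRW

open FreeProductBRW

set_option linter.unusedSectionVars false

namespace FreeProductBRW

/-! Write A for the transition operator, so that (A^n w)(x) = E[w(x Y_n)], F(n, d) for the
probability of |Y_n| ≤ d, and f for the offspring generating function. Splitting at the first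
generation shows that generation n avoids a set with a probability that is the n-th iterate of u ↦
f(A u), started from the indicator of the complement (`measure_avoidEvent`). Both halves of the
theorem are estimates for this iteration followed by Borel–Cantelli.

Lower bound: since 1 - f(1 - δ) ≤ ρδ, a particle of generation n lies within distance xn with
probability at most ρ^n F(n, ⌊xn⌋). By Markov's inequality this is exponentially small once log ρ <
-τx - Λ(-τ) for some τ ≥ 0.

Upper bound: if ρ^L F(L, d) > 1, the descendants that move by at most d in each block of L
generations grow supercritically, so with probability at least some ε > 0, whatever k is, one of
them is within distance kd after k blocks. A short initial stretch of generations, in which the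
population multiplies, turns the failure probability 1 - ε into an exponentially small one.

Blocks with d/L near v_min come from a duality argument in place of a large deviation principle. F
is supermultiplicative in (n, d) jointly. If ρ^n F(n, d) ≤ 1 whenever d ≤ xn, a supporting line
gives τ ≥ 0 with ρ^n F(n, d) ≤ exp(τ(d - xn)) for all n ≥ 1 and all d, hence Λ(-τ) ≤ -log ρ - τx.
This is impossible for x > v_min if log ρ ≤ -log r, because v_min is then the supremum of -(Λ(-τ) +
log ρ)/τ over τ > 0 (`legendre_level`). If log ρ > -log r, blocks with d = 0 exist.

The free product structure ensures that the level log ρ is attained by I even when that supremum is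
0: some τ₀ has Λ(-τ₀) ≤ log r. A reachable y has a reduced word whose letters can each be undone by
the walk, in bounded time and with probability bounded below, so returning from y costs at most a
factor exponential in |y|. -/

theorem sum_toReal_support {H : Type*} {μ : PMF H} (hμ : μ.support.Finite) :
    ∑ g ∈ hμ.toFinset, (μ g).toReal = 1 := by
  rw [← ENNReal.toReal_sum fun g _ => μ.apply_ne_top g, ← ENNReal.toReal_one, ← μ.tsum_coe,
    tsum_eq_sum (s := hμ.toFinset)]
  intro g hg
  exact (PMF.apply_eq_zero_iff μ g).2 (by simpa using hg)

/-! ### The transition operator and ball probabilities -/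

section TransitionOperator

variable {H : Type*} [Group H] {μ : PMF H} (hμ : μ.support.Finite)

/-- The transition operator `u ↦ (x ↦ E[u (x * g)])`, `g` of law `μ`, of the random walk. -/
noncomputable def transitionOp : (H → ℝ) →ₗ[ℝ] (H → ℝ) where
  toFun u x := ∑ g ∈ hμ.toFinset, (μ g).toReal * u (x * g)
  map_add' u v := by
    funext x
    simp only [Pi.add_apply, mul_add, Finset.sum_add_distrib]
  map_smul' c u := by
    funext x
    simp only [Pi.smul_apply, smul_eq_mul, RingHom.id_apply, Finset.mul_sum]
    exact Finset.sum_congr rfl fun g _ => by ring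

theorem transitionOp_apply (u : H → ℝ) (x : H) :
    transitionOp hμ u x = ∑ g ∈ hμ.toFinset, (μ g).toReal * u (x * g) := rfl

/-- Monotonicity of the powers of the transition operator on the set of reachable points. -/
theorem pow_transitionOp_le (R : ℕ → Set H)
    (hR : ∀ i, ∀ x ∈ R i, ∀ g ∈ μ.support, x * g ∈ R (i + 1)) {w w' : H → ℝ} (n : ℕ) :
    ∀ i, (∀ y ∈ R (i + n), w y ≤ w' y) → ∀ x ∈ R i,
      (transitionOp hμ ^ n) w x ≤ (transitionOp hμ ^ n) w' x := by
  induction n with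
  | zero => intro i h x hx; simpa using h x (by simpa using hx)
  | succ n ih =>
    intro i h x hx
    rw [pow_succ', Module.End.mul_apply, Module.End.mul_apply, transitionOp_apply,
      transitionOp_apply]
    refine Finset.sum_le_sum fun g hg => mul_le_mul_of_nonneg_left ?_ ENNReal.toReal_nonneg
    refine ih (i + 1) (fun y hy => h y ?_) _ (hR i x hx g (by simpa using hg))
    rwa [show i + (n + 1) = i + 1 + n by ring]

theorem pow_transitionOp_mono {w w' : H → ℝ} (h : ∀ y, w y ≤ w' y) (n : ℕ) (x : H) :
    (transitionOp hμ ^ n) w x ≤ (transitionOp hμ ^ n) w' x :=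
  pow_transitionOp_le hμ (fun _ => Set.univ) (fun _ _ _ _ _ => trivial) n 0 (fun y _ => h y) x
    trivial

theorem pow_transitionOp_const (c : ℝ) (n : ℕ) :
    (transitionOp hμ ^ n) (fun _ => c) = fun _ => c := by
  induction n with
  | zero => simp
  | succ n ih =>
    rw [pow_succ, Module.End.mul_apply]
    convert ih
    rw [transitionOp_apply, ← Finset.sum_mul, sum_toReal_support, one_mul]

theorem pow_transitionOp_nonneg {w : H → ℝ} (h : ∀ y, 0 ≤ w y) (n : ℕ) (x : H) :
    0 ≤ (transitionOp hμ ^ n) w x := by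
  have := pow_transitionOp_mono hμ h n x
  rwa [pow_transitionOp_const] at this

theorem pow_transitionOp_le_one {w : H → ℝ} (h : ∀ y, w y ≤ 1) (n : ℕ) (x : H) :
    (transitionOp hμ ^ n) w x ≤ 1 := by
  have := pow_transitionOp_mono hμ h n x
  rwa [pow_transitionOp_const] at this

theorem pow_transitionOp_translate (w : H → ℝ) (y : H) (n : ℕ) (x : H) :
    (transitionOp hμ ^ n) (fun z => w (y * z)) x = (transitionOp hμ ^ n) w (y * x) := by
  induction n generalizing x with
  | zero => simp
  | succ n ih =>
    rw [pow_succ', Module.End.mul_apply, Module.End.mul_apply, transitionOp_apply,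
      transitionOp_apply]
    exact Finset.sum_congr rfl fun g _ => by rw [ih, mul_assoc]

theorem walkLaw_one (μ : PMF H) : walkLaw μ 1 = μ := by
  simp only [walkLaw, PMF.pure_bind, one_mul]
  exact PMF.map_id μ

/-- The bridge from `walkLaw` to powers of the operator. The first step is split off here, although
`walkLaw` is built by adding a last step. -/
theorem tsum_walkLaw_mul_ofReal {w : H → ℝ} (hw : ∀ y, 0 ≤ w y) (n : ℕ) (x : H) :
    ∑' y, walkLaw μ n y * ENNReal.ofReal (w (x * y))
      = ENNReal.ofReal ((transitionOp hμ ^ n) w x) := by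
  induction n generalizing x with
  | zero =>
    rw [tsum_eq_single 1 fun z hz => by simp [walkLaw, hz]]
    simp [walkLaw]
  | succ n ih =>
    rw [add_comm n 1, tsum_walkLaw_add μ 1 n, walkLaw_one, pow_add, pow_one,
      Module.End.mul_apply, transitionOp_apply,
      ENNReal.ofReal_sum_of_nonneg fun g _ =>
        mul_nonneg ENNReal.toReal_nonneg (pow_transitionOp_nonneg hμ hw n _),
      tsum_eq_sum (s := hμ.toFinset)]
    · refine Finset.sum_congr rfl fun g _ => ?_
      rw [ENNReal.ofReal_mul ENNReal.toReal_nonneg, ENNReal.ofReal_toReal (μ.apply_ne_top g),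
        ← ih]
      simp only [mul_assoc]
    · intro g hg
      rw [(PMF.apply_eq_zero_iff μ g).2 (by simpa using hg), zero_mul]

theorem toReal_walkLaw_one (n : ℕ) :
    (walkLaw μ n 1).toReal = (transitionOp hμ ^ n) (Set.indicator {1} 1) 1 := by
  have h0 : ∀ y : H, 0 ≤ Set.indicator ({1} : Set H) (1 : H → ℝ) y :=
    fun y => Set.indicator_nonneg (fun _ _ => zero_le_one) y
  rw [← ENNReal.toReal_ofReal (pow_transitionOp_nonneg hμ h0 n 1),
    ← tsum_walkLaw_mul_ofReal hμ h0, tsum_eq_single 1 fun z hz => by simp [hz]]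
  simp

theorem integral_walkLaw [Countable H] [MeasurableSpace H] [DiscreteMeasurableSpace H]
    {w : H → ℝ} (hw : ∀ y, 0 ≤ w y) (n : ℕ) :
    ∫ x, w x ∂(walkLaw μ n).toMeasure = (transitionOp hμ ^ n) w 1 := by
  rw [integral_eq_lintegral_of_nonneg_ae (ae_of_all _ hw)
      (measurable_of_countable _).aestronglyMeasurable, lintegral_countable']
  simp only [PMF.toMeasure_apply_singleton _ _ (MeasurableSet.singleton _)]
  rw [← ENNReal.toReal_ofReal (pow_transitionOp_nonneg hμ hw n 1),
    ← tsum_walkLaw_mul_ofReal hμ hw]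
  simp only [one_mul, mul_comm]

theorem wordLength_one (S : Set H) : wordLength S (1 : H) = 0 := by
  simp [wordLength]

/-- The indicator function of the ball of radius `d` about the identity. -/
noncomputable def ballIndicator (S : Set H) (d : ℕ) : H → ℝ :=
  Set.indicator {y | wordLength S y ≤ d} 1

theorem ballIndicator_nonneg (S : Set H) (d : ℕ) (y : H) : 0 ≤ ballIndicator S d y :=
  Set.indicator_nonneg (fun _ _ => zero_le_one) y

theorem ballIndicator_le_one (S : Set H) (d : ℕ) (y : H) : ballIndicator S d y ≤ 1 :=
  Set.indicator_le_self' (fun _ _ => zero_le_one) y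

/-- The probability that the walk is in the ball of radius `d` at time `n`. -/
noncomputable def ballProb (S : Set H) (n d : ℕ) : ℝ :=
  (transitionOp hμ ^ n) (ballIndicator S d) 1

theorem ballProb_nonneg (S : Set H) (n d : ℕ) : 0 ≤ ballProb hμ S n d :=
  pow_transitionOp_nonneg hμ (ballIndicator_nonneg S d) n 1

/-- By the triangle inequality, the translate by y of the ball of radius d lies in the ball of
radius d'. -/
theorem ballProb_le_pow {S : Set H} (hS : Subgroup.closure S = ⊤) (n d d' : ℕ) {y : H}
    (hy : wordLength S y + d ≤ d') :
    ballProb hμ S n d ≤ (transitionOp hμ ^ n) (ballIndicator S d') y := by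
  have := pow_transitionOp_translate hμ (ballIndicator S d') y n 1
  rw [mul_one] at this
  rw [← this]
  refine pow_transitionOp_mono hμ (fun z => ?_) n 1
  by_cases hz : wordLength S z ≤ d
  · have h2 : wordLength S (y * z) ≤ d' := (wordLength_mul_le hS y z).trans (by omega)
    simp [ballIndicator, hz, h2]
  · rw [ballIndicator, Set.indicator_of_notMem (by simpa using hz)]
    exact ballIndicator_nonneg S d' _

/-- Markov property at time n: from any point of the ball of radius d, a further displacement of at
most d' stays in the ball of radius d + d'. -/
theorem ballProb_mul_le {S : Set H} (hS : Subgroup.closure S = ⊤) (n n' d d' : ℕ) :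
    ballProb hμ S n d * ballProb hμ S n' d' ≤ ballProb hμ S (n + n') (d + d') := by
  have h : ∀ y, ballProb hμ S n' d' * ballIndicator S d y
      ≤ (transitionOp hμ ^ n') (ballIndicator S (d + d')) y := fun y => by
    by_cases hy : wordLength S y ≤ d
    · rw [ballIndicator, Set.indicator_of_mem (by simpa using hy), Pi.one_apply, mul_one]
      exact ballProb_le_pow hμ hS n' d' _ (by omega)
    · rw [ballIndicator, Set.indicator_of_notMem (by simpa using hy), mul_zero]
      exact pow_transitionOp_nonneg hμ (ballIndicator_nonneg S _) n' y
  have h2 := pow_transitionOp_mono hμ h n 1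
  rw [← Module.End.mul_apply, ← pow_add] at h2
  refine le_trans (le_of_eq ?_) h2
  have h3 := congrFun (map_smul (transitionOp hμ ^ n) (ballProb hμ S n' d') (ballIndicator S d)) 1
  simp only [Pi.smul_apply, smul_eq_mul] at h3
  rw [ballProb, mul_comm, ← h3]
  rfl

end TransitionOperator

/-! ### Bounded steps -/

section StepLength

variable {H : Type*} [Group H]

/-- A uniform bound on the length of the steps of the walk. -/
theorem exists_wordLength_le {μ : PMF H} (hμ : μ.support.Finite) (S : Set H) :
    ∃ K : ℕ, ∀ g ∈ μ.support, wordLength S g ≤ K := by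
  obtain ⟨K, hK⟩ := (hμ.image (wordLength S)).bddAbove
  exact ⟨K, fun g hg => hK ⟨g, hg, rfl⟩⟩

theorem wordLength_mul_step_le {μ : PMF H} {S : Set H} (hS : Subgroup.closure S = ⊤) {K : ℕ}
    (hK : ∀ g ∈ μ.support, wordLength S g ≤ K) :
    ∀ i, ∀ x ∈ {y : H | wordLength S y ≤ K * i}, ∀ g ∈ μ.support,
      x * g ∈ {y : H | wordLength S y ≤ K * (i + 1)} := by
  intro i x hx g hg
  simp only [Set.mem_ofPred_eq] at hx ⊢
  have := wordLength_mul_le hS x g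
  have := hK g hg
  rw [mul_add, mul_one]
  omega

end StepLength

/-! ### Estimates on the offspring generating function -/

section GeneratingFunction

/-- The probability generating function of `π`. -/
noncomputable def genFun (π : PMF ℕ) (s : ℝ) : ℝ := ∑' k, (π k).toReal * s ^ k

theorem hasSum_toReal (π : PMF ℕ) : HasSum (fun k => (π k).toReal) 1 := by
  have h := ENNReal.hasSum_toReal (f := π) (by rw [π.tsum_coe]; exact ENNReal.one_ne_top)
  rwa [← ENNReal.tsum_toReal_eq fun k => π.apply_ne_top k, π.tsum_coe, ENNReal.toReal_one] at h

theorem summable_genFun (π : PMF ℕ) {s : ℝ} (h0 : 0 ≤ s) (h1 : s ≤ 1) :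
    Summable fun k => (π k).toReal * s ^ k :=
  (hasSum_toReal π).summable.of_nonneg_of_le
    (fun k => mul_nonneg ENNReal.toReal_nonneg (pow_nonneg h0 k))
    fun _ => mul_le_of_le_one_right ENNReal.toReal_nonneg (pow_le_one₀ h0 h1)

theorem genFun_mono (π : PMF ℕ) {s t : ℝ} (h0 : 0 ≤ s) (hst : s ≤ t) (h1 : t ≤ 1) :
    genFun π s ≤ genFun π t :=
  (summable_genFun π h0 (hst.trans h1)).tsum_le_tsum
    (fun k => mul_le_mul_of_nonneg_left (pow_le_pow_left₀ h0 hst k) ENNReal.toReal_nonneg)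
    (summable_genFun π (h0.trans hst) h1)

theorem genFun_one (π : PMF ℕ) : genFun π 1 = 1 := by
  simp only [genFun, one_pow, mul_one, (hasSum_toReal π).tsum_eq]

theorem genFun_nonneg (π : PMF ℕ) {s : ℝ} (h0 : 0 ≤ s) : 0 ≤ genFun π s :=
  tsum_nonneg fun k => mul_nonneg ENNReal.toReal_nonneg (pow_nonneg h0 k)

theorem genFun_le_one (π : PMF ℕ) {s : ℝ} (h0 : 0 ≤ s) (h1 : s ≤ 1) : genFun π s ≤ 1 :=
  genFun_one π ▸ genFun_mono π h0 h1 le_rfl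

theorem hasSum_one_sub_genFun (π : PMF ℕ) {s : ℝ} (h0 : 0 ≤ s) (h1 : s ≤ 1) :
    HasSum (fun k => (π k).toReal * (1 - s ^ k)) (1 - genFun π s) := by
  have := (hasSum_toReal π).sub (summable_genFun π h0 h1).hasSum
  simpa only [mul_sub, mul_one, genFun] using this

variable {π : PMF ℕ} {ρ : ℝ} (hρ : HasSum (fun k : ℕ => (k : ℝ) * (π k).toReal) ρ)

include hρ in
theorem one_sub_genFun_le {δ : ℝ} (h0 : 0 ≤ δ) (h1 : δ ≤ 1) :
    1 - genFun π (1 - δ) ≤ ρ * δ := by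
  refine hasSum_le (fun k => ?_) (hasSum_one_sub_genFun π (by linarith) (by linarith))
    (hρ.mul_right δ)
  have := one_add_mul_le_pow (a := -δ) (by linarith) k
  rw [show 1 + -δ = 1 - δ by ring] at this
  rw [mul_right_comm, mul_comm]
  exact mul_le_mul_of_nonneg_right (by linarith) ENNReal.toReal_nonneg

include hρ in
-- Only the first moment is available, so the mean is truncated at a partial sum M > ρ', and for the
-- finitely many terms left the linear behaviour of 1 - (1 - δ)^k near δ = 0 is uniform.
theorem exists_genFun_le {ρ' : ℝ} (h0 : 0 < ρ') (hlt : ρ' < ρ) :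
    ∃ δ₀ : ℝ, 0 < δ₀ ∧ δ₀ ≤ 1 ∧ ∀ δ, 0 ≤ δ → δ ≤ δ₀ → genFun π (1 - δ) ≤ 1 - ρ' * δ := by
  obtain ⟨N, hN⟩ := ((hρ.tendsto_sum_nat).eventually_const_lt hlt).exists
  set M := ∑ k ∈ Finset.range N, (k : ℝ) * (π k).toReal with hM
  -- The bound on δ is what makes ρ'(1 + Nδ) ≤ M.
  refine ⟨min 1 ((M - ρ') / ((N + 1) * ρ')), lt_min one_pos ?_, min_le_left _ _,
    fun δ hδ hδ₀ => ?_⟩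
  · exact div_pos (by linarith) (by positivity)
  have hδ1 : δ ≤ 1 := hδ₀.trans (min_le_left _ _)
  have hδ2 : δ * ((N + 1) * ρ') ≤ M - ρ' :=
    (le_div_iff₀ (by positivity)).1 (hδ₀.trans (min_le_right _ _))
  have hs := hasSum_one_sub_genFun π (s := 1 - δ) (by linarith) (by linarith)
  have hNδ : 0 < 1 + N * δ := by positivity
  have key : M * δ / (1 + N * δ) ≤ 1 - genFun π (1 - δ) := by
    refine le_trans ?_ (sum_le_hasSum (Finset.range N) (fun k _ =>
      mul_nonneg ENNReal.toReal_nonneg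
        (sub_nonneg.2 (pow_le_one₀ (by linarith) (by linarith)))) hs)
    rw [hM, Finset.sum_mul, Finset.sum_div]
    refine Finset.sum_le_sum fun k hk => ?_
    have hkN : (k : ℝ) ≤ N := by exact_mod_cast (Finset.mem_range.1 hk).le
    have h1 : 1 + k * δ ≤ (1 + δ) ^ k := one_add_mul_le_pow (by linarith) k
    -- With Bernoulli's inequality for (1 + δ)^k this yields (1 - δ)^k ≤ 1/(1 + kδ).
    have h2 : (1 - δ) ^ k * (1 + δ) ^ k ≤ 1 := by
      rw [← mul_pow]
      exact pow_le_one₀ (mul_nonneg (by linarith) (by linarith)) (by nlinarith)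
    have h3 : 0 ≤ (1 - δ) ^ k := pow_nonneg (by linarith) k
    have h4 : (1 - δ) ^ k * (1 + k * δ) ≤ 1 := (mul_le_mul_of_nonneg_left h1 h3).trans h2
    have hkδ : 0 < 1 + k * δ := by positivity
    have h5 : k * δ / (1 + N * δ) ≤ 1 - (1 - δ) ^ k := by
      have : k * δ / (1 + N * δ) ≤ k * δ / (1 + k * δ) := by gcongr
      refine this.trans ((div_le_iff₀ hkδ).2 ?_)
      linarith
    calc (k : ℝ) * (π k).toReal * δ / (1 + N * δ)
        = (π k).toReal * (k * δ / (1 + N * δ)) := by ring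
      _ ≤ _ := mul_le_mul_of_nonneg_left h5 ENNReal.toReal_nonneg
  have : ρ' * δ ≤ M * δ / (1 + N * δ) := by
    rw [le_div_iff₀ hNδ]
    have : ρ' * (1 + N * δ) ≤ M := by nlinarith [mul_nonneg hδ h0.le]
    nlinarith
  linarith

include hρ in
theorem toReal_one_lt_one (hρ_one : 1 < ρ) : (π 1).toReal < 1 := by
  by_contra! h
  have h1 : ∀ k, k ≠ 1 → (π k).toReal = 0 := fun k hk => by
    have := sum_le_hasSum {1, k} (fun _ _ => ENNReal.toReal_nonneg) (hasSum_toReal π)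
    rw [Finset.sum_pair hk.symm] at this
    exact le_antisymm (by linarith) ENNReal.toReal_nonneg
  have h2 : ρ = (π 1).toReal := by
    rw [← hρ.tsum_eq, tsum_eq_single 1 fun k hk => by rw [h1 k hk, mul_zero]]
    simp
  have h3 : (π 1).toReal ≤ 1 := by
    rw [← ENNReal.toReal_one]
    exact ENNReal.toReal_mono ENNReal.one_ne_top (π.coe_le_one 1)
  linarith

include hρ in
-- For t ≤ c every power t^k with k ≥ 2 is at most ct, so κ only has to exceed π(1)(1 - c) + c,
-- which is below 1 because π(1) < 1.
theorem exists_genFun_le_mul (hρ_one : 1 < ρ) (hπ_zero : π 0 = 0) {c : ℝ} (hc0 : 0 ≤ c)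
    (hc : c < 1) :
    ∃ κ : ℝ, 0 < κ ∧ κ < 1 ∧ ∀ t, 0 ≤ t → t ≤ c → genFun π t ≤ κ * t := by
  have hp := toReal_one_lt_one hρ hρ_one
  have hp0 : 0 ≤ (π 1).toReal := ENNReal.toReal_nonneg
  obtain ⟨κ, hκ1, hκ2⟩ : ∃ κ, (π 1).toReal * (1 - c) + c < κ ∧ κ < 1 :=
    exists_between (by nlinarith)
  refine ⟨κ, by nlinarith, hκ2, fun t ht0 ht => ?_⟩
  have hs := (hasSum_ite_eq (1 : ℕ) ((π 1).toReal * (t * (1 - c)))).add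
    ((hasSum_toReal π).mul_right (t * c))
  refine (hasSum_le (fun k => ?_) (summable_genFun π ht0 (by linarith)).hasSum hs).trans ?_
  · have hpk : 0 ≤ (π k).toReal := ENNReal.toReal_nonneg
    match k with
    | 0 => simp [hπ_zero]
    | 1 => simp only [pow_one, if_true]; linarith
    | k + 2 =>
      have h1 : t ^ k ≤ 1 := pow_le_one₀ ht0 (by linarith)
      have h2 : t ^ (k + 2) ≤ t * c := by
        calc t ^ (k + 2) = t ^ k * (t * t) := by ring
          _ ≤ 1 * (t * c) := by gcongr
          _ = t * c := one_mul _
      rw [if_neg (by omega), zero_add]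
      exact mul_le_mul_of_nonneg_left h2 hpk
  · nlinarith

end GeneratingFunction

/-! ### The branching operator: first moment bound and survival -/

section BranchingOperator

variable {H : Type*} [Group H] {μ : PMF H} (hμ : μ.support.Finite) (π : PMF ℕ)

/-- The operator `u ↦ (x ↦ f (E[u (x * g)]))` of the branching random walk, `f` being the
generating function of the offspring distribution. -/
noncomputable def branchingOp (u : H → ℝ) (x : H) : ℝ := genFun π (transitionOp hμ u x)

theorem transitionOp_mem_Icc {u : H → ℝ} (hu : ∀ x, u x ∈ Set.Icc 0 1) (x : H) :
    transitionOp hμ u x ∈ Set.Icc 0 1 := by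
  have h0 := pow_transitionOp_nonneg hμ (fun y => (hu y).1) 1 x
  have h1 := pow_transitionOp_le_one hμ (fun y => (hu y).2) 1 x
  rw [pow_one] at h0 h1
  exact ⟨h0, h1⟩

theorem branchingOp_mem_Icc {u : H → ℝ} (hu : ∀ x, u x ∈ Set.Icc 0 1) (x : H) :
    branchingOp hμ π u x ∈ Set.Icc 0 1 := by
  have h := transitionOp_mem_Icc hμ hu x
  exact ⟨genFun_nonneg π h.1, genFun_le_one π h.1 h.2⟩

theorem branchingOp_iterate_mem_Icc {u : H → ℝ} (hu : ∀ x, u x ∈ Set.Icc 0 1) (n : ℕ) (x : H) :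
    (branchingOp hμ π)^[n] u x ∈ Set.Icc 0 1 := by
  induction n generalizing x with
  | zero => exact hu x
  | succ n ih =>
    rw [Function.iterate_succ_apply']
    exact branchingOp_mem_Icc hμ π ih x

/-- Monotonicity of the iterates of the branching operator on the set of reachable points. -/
theorem branchingOp_iterate_le (R : ℕ → Set H)
    (hR : ∀ i, ∀ x ∈ R i, ∀ g ∈ μ.support, x * g ∈ R (i + 1)) {w w' : H → ℝ}
    (hw : ∀ x, w x ∈ Set.Icc 0 1) (hw' : ∀ x, w' x ∈ Set.Icc 0 1) (n : ℕ) :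
    ∀ i, (∀ y ∈ R (i + n), w y ≤ w' y) → ∀ x ∈ R i,
      (branchingOp hμ π)^[n] w x ≤ (branchingOp hμ π)^[n] w' x := by
  induction n with
  | zero => intro i h x hx; exact h x hx
  | succ n ih =>
    intro i h x hx
    rw [Function.iterate_succ_apply', Function.iterate_succ_apply']
    refine genFun_mono π (transitionOp_mem_Icc hμ (branchingOp_iterate_mem_Icc hμ π hw n) x).1 ?_
      (transitionOp_mem_Icc hμ (branchingOp_iterate_mem_Icc hμ π hw' n) x).2
    rw [transitionOp_apply, transitionOp_apply]
    refine Finset.sum_le_sum fun g hg => mul_le_mul_of_nonneg_left ?_ ENNReal.toReal_nonneg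
    refine ih (i + 1) (fun y hy => h y ?_) _ (hR i x hx g (by simpa using hg))
    rwa [show i + (n + 1) = i + 1 + n by ring]

theorem branchingOp_iterate_mono {w w' : H → ℝ} (hw : ∀ x, w x ∈ Set.Icc 0 1)
    (hw' : ∀ x, w' x ∈ Set.Icc 0 1) (h : ∀ y, w y ≤ w' y) (n : ℕ) (x : H) :
    (branchingOp hμ π)^[n] w x ≤ (branchingOp hμ π)^[n] w' x :=
  branchingOp_iterate_le hμ π (fun _ => Set.univ) (fun _ _ _ _ _ => trivial) hw hw' n 0
    (fun y _ => h y) x trivial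

theorem transitionOp_const (c : ℝ) : transitionOp hμ (fun _ => c) = fun _ => c := by
  have := pow_transitionOp_const hμ c 1
  rwa [pow_one] at this

theorem transitionOp_one_sub (w : H → ℝ) (x : H) :
    transitionOp hμ (fun y => 1 - w y) x = 1 - transitionOp hμ w x := by
  have h := congrFun (map_sub (transitionOp hμ) (fun _ => 1) w) x
  rw [transitionOp_const] at h
  exact h

theorem branchingOp_iterate_const (c : ℝ) (n : ℕ) :
    (branchingOp hμ π)^[n] (fun _ => c) = fun _ => (genFun π)^[n] c := by
  induction n with
  | zero => rfl
  | succ n ih =>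
    rw [Function.iterate_succ_apply', ih, Function.iterate_succ_apply']
    funext x
    rw [branchingOp, transitionOp_const]

variable {π} {ρ : ℝ} (hρ : HasSum (fun k : ℕ => (k : ℝ) * (π k).toReal) ρ)

include hρ in
/-- First moment bound. -/
theorem one_sub_branchingOp_iterate_le (hρ0 : 0 ≤ ρ) {h : H → ℝ} (hh : ∀ x, h x ∈ Set.Icc 0 1)
    (n : ℕ) (x : H) :
    1 - (branchingOp hμ π)^[n] (fun y => 1 - h y) x ≤ ρ ^ n * (transitionOp hμ ^ n) h x := by
  have hh' : ∀ x, 1 - h x ∈ Set.Icc (0 : ℝ) 1 := fun x =>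
    ⟨by linarith [(hh x).2], by linarith [(hh x).1]⟩
  induction n generalizing x with
  | zero => simp
  | succ n ih =>
    set v : H → ℝ := fun y => 1 - (branchingOp hμ π)^[n] (fun y => 1 - h y) y with hv
    have hvI : ∀ y, v y ∈ Set.Icc (0 : ℝ) 1 := fun y => by
      have := branchingOp_iterate_mem_Icc hμ π hh' n y
      exact ⟨by simp only [hv]; linarith [this.2], by simp only [hv]; linarith [this.1]⟩
    have hAv := transitionOp_mem_Icc hμ hvI x
    have h1 : (branchingOp hμ π)^[n] (fun y => 1 - h y) = fun y => 1 - v y := by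
      funext y; simp [hv]
    rw [Function.iterate_succ_apply', h1, branchingOp, transitionOp_one_sub]
    refine (one_sub_genFun_le hρ hAv.1 hAv.2).trans ?_
    rw [pow_succ', pow_succ', Module.End.mul_apply, mul_assoc]
    refine mul_le_mul_of_nonneg_left ?_ hρ0
    rw [transitionOp_apply, transitionOp_apply, Finset.mul_sum]
    refine Finset.sum_le_sum fun g _ => ?_
    rw [mul_left_comm]
    exact mul_le_mul_of_nonneg_left (ih _) ENNReal.toReal_nonneg

/-- A converse to the first moment bound with ρ' in place of ρ: while ερ'^n ≤ δ₀, the iteration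
stays where f(1 - δ) ≤ 1 - ρ'δ applies. -/
theorem branchingOp_iterate_le_one_sub {ρ' δ₀ : ℝ} (hρ' : 1 ≤ ρ') (hδ₀ : δ₀ ≤ 1)
    (hf : ∀ δ, 0 ≤ δ → δ ≤ δ₀ → genFun π (1 - δ) ≤ 1 - ρ' * δ) {h : H → ℝ}
    (hh : ∀ x, h x ∈ Set.Icc 0 1) {ε : ℝ} (hε : 0 ≤ ε) (n : ℕ) (hn : ε * ρ' ^ n ≤ δ₀) (x : H) :
    (branchingOp hμ π)^[n] (fun y => 1 - ε * h y) x
      ≤ 1 - ε * ρ' ^ n * (transitionOp hμ ^ n) h x := by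
  induction n generalizing x with
  | zero => simp
  | succ n ih =>
    have hn' : ε * ρ' ^ n ≤ δ₀ := by
      refine le_trans ?_ hn
      exact mul_le_mul_of_nonneg_left (pow_le_pow_right₀ hρ' (Nat.le_succ n)) hε
    have hε1 : ε ≤ 1 := by
      refine le_trans ?_ (hn'.trans hδ₀)
      exact le_mul_of_one_le_right hε (one_le_pow₀ hρ')
    have hA0 : ∀ k y, 0 ≤ (transitionOp hμ ^ k) h y :=
      fun k y => pow_transitionOp_nonneg hμ (fun y => (hh y).1) k y
    have hA1 : ∀ k y, (transitionOp hμ ^ k) h y ≤ 1 :=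
      fun k y => pow_transitionOp_le_one hμ (fun y => (hh y).2) k y
    have hu : ∀ y, 1 - ε * h y ∈ Set.Icc (0 : ℝ) 1 := fun y =>
      ⟨by nlinarith [(hh y).1, (hh y).2], by nlinarith [(hh y).1]⟩
    set w : H → ℝ := fun y => ε * ρ' ^ n * (transitionOp hμ ^ n) h y with hw
    have hc0 : 0 ≤ ε * ρ' ^ n := mul_nonneg hε (pow_nonneg (by linarith) n)
    have hAw : transitionOp hμ w x = ε * ρ' ^ n * (transitionOp hμ ^ (n + 1)) h x := by
      have := congrFun (map_smul (transitionOp hμ) (ε * ρ' ^ n) ((transitionOp hμ ^ n) h)) x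
      rw [pow_succ', Module.End.mul_apply]
      exact this
    have hAw0 : 0 ≤ transitionOp hμ w x := hAw ▸ mul_nonneg hc0 (hA0 _ _)
    have hAw1 : transitionOp hμ w x ≤ δ₀ :=
      hAw ▸ (mul_le_of_le_one_right hc0 (hA1 _ _)).trans hn'
    rw [Function.iterate_succ_apply', branchingOp]
    have hle : transitionOp hμ ((branchingOp hμ π)^[n] fun y => 1 - ε * h y) x
        ≤ 1 - transitionOp hμ w x := by
      rw [← transitionOp_one_sub, transitionOp_apply, transitionOp_apply]
      exact Finset.sum_le_sum fun g _ =>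
        mul_le_mul_of_nonneg_left (ih hn' _) ENNReal.toReal_nonneg
    refine (genFun_mono π (transitionOp_mem_Icc hμ (branchingOp_iterate_mem_Icc hμ π hu n) x).1
      hle (by linarith)).trans ((hf _ hAw0 hAw1).trans (le_of_eq ?_))
    rw [hAw]
    ring

/-- The indicator of the complement of the ball of radius `a`. -/
noncomputable def coBall (S : Set H) (a : ℕ) (y : H) : ℝ := 1 - ballIndicator S a y

theorem coBall_mem_Icc (S : Set H) (a : ℕ) (y : H) : coBall S a y ∈ Set.Icc (0 : ℝ) 1 :=
  ⟨by rw [coBall]; linarith [ballIndicator_le_one S a y],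
    by rw [coBall]; linarith [ballIndicator_nonneg S a y]⟩

include hρ in
-- Survival of the process of blocks, by induction on their number: a success probability ε on the
-- smaller ball is multiplied by at least ρ'^L F(L, d) > 1 over one more block, so ε is not lost. It
-- is independent of k and a.
theorem exists_branchingOp_coBall_le_one_sub {S : Set H} (hS : Subgroup.closure S = ⊤)
    (hρ_one : 1 < ρ) {L d : ℕ} (hL : 1 < ρ ^ L * ballProb hμ S L d) :
    ∃ ε : ℝ, 0 < ε ∧ ε ≤ 1 ∧ ∀ k a : ℕ, ∀ y, wordLength S y + k * d ≤ a →
      (branchingOp hμ π)^[k * L] (coBall S a) y ≤ 1 - ε := by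
  obtain ⟨ρ', ⟨hρ'1, hρ'2⟩, hρ'3⟩ : ∃ ρ', (1 < ρ' ∧ ρ' < ρ) ∧ 1 < ρ' ^ L * ballProb hμ S L d := by
    have h1 : ∀ᶠ r in 𝓝[<] ρ, 1 < r ^ L * ballProb hμ S L d := by
      have hc : Continuous fun r : ℝ => r ^ L * ballProb hμ S L d := by fun_prop
      exact nhdsWithin_le_nhds ((hc.tendsto ρ).eventually_const_lt hL)
    have h2 : ∀ᶠ r in 𝓝[<] ρ, r ∈ Set.Ioo 1 ρ := Ioo_mem_nhdsLT hρ_one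
    exact (h2.and h1).exists
  obtain ⟨δ₀, hδ0, hδ1, hδ⟩ := exists_genFun_le hρ (by linarith) hρ'2
  have hρL : 0 < ρ' ^ L := pow_pos (by linarith) L
  have hρL1 : 1 ≤ ρ' ^ L := one_le_pow₀ hρ'1.le
  -- The largest ε for which the linearised growth over L generations does not exceed δ₀.
  refine ⟨δ₀ / ρ' ^ L, by positivity, (div_le_one hρL).2 (hδ1.trans hρL1), fun k => ?_⟩
  set ε := δ₀ / ρ' ^ L with hε
  have hε0 : 0 < ε := by positivity
  have hε1 : ε ≤ 1 := (div_le_one hρL).2 (hδ1.trans hρL1)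
  have hεL : ε * ρ' ^ L ≤ δ₀ := by rw [hε, div_mul_cancel₀ _ hρL.ne']
  induction k with
  | zero =>
    intro a y hy
    have : wordLength S y ≤ a := by omega
    simp [coBall, ballIndicator, this, hε1]
  | succ k ih =>
    intro a y hy
    rw [add_mul, one_mul, add_comm, Function.iterate_add_apply]
    have hkd : k * d ≤ a := by rw [add_mul] at hy; omega
    have hIcc : ∀ x, ballIndicator S (a - k * d) x ∈ Set.Icc (0 : ℝ) 1 :=
      fun x => ⟨ballIndicator_nonneg _ _ _, ballIndicator_le_one _ _ _⟩
    have hle : ∀ x, (branchingOp hμ π)^[k * L] (coBall S a) x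
        ≤ 1 - ε * ballIndicator S (a - k * d) x := fun x => by
      by_cases hx : wordLength S x ≤ a - k * d
      · rw [ballIndicator, Set.indicator_of_mem (by simpa using hx), Pi.one_apply, mul_one]
        exact ih a x (by omega)
      · rw [ballIndicator, Set.indicator_of_notMem (by simpa using hx), mul_zero, sub_zero]
        exact (branchingOp_iterate_mem_Icc hμ π (coBall_mem_Icc S a) _ x).2
    refine (branchingOp_iterate_mono hμ π
      (branchingOp_iterate_mem_Icc hμ π (coBall_mem_Icc S a) _)
      (fun x => ⟨by nlinarith [(hIcc x).1, (hIcc x).2], by nlinarith [(hIcc x).1]⟩) hle L y).trans ?_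
    refine (branchingOp_iterate_le_one_sub hμ hρ'1.le hδ1 hδ hIcc hε0.le L hεL y).trans ?_
    have h1 := ballProb_le_pow hμ hS L d (a - k * d) (y := y)
      (by rw [add_mul] at hy; omega)
    have h2 : 1 ≤ ρ' ^ L * (transitionOp hμ ^ L) (ballIndicator S (a - k * d)) y :=
      hρ'3.le.trans (mul_le_mul_of_nonneg_left h1 hρL.le)
    nlinarith

include hρ in
-- In the first s generations all particles stay within distance Ks, and from there each fails with
-- probability at most 1 - ε. Failure of all of them is bounded by the s-th iterate of f at 1 - ε,
-- which decays geometrically as π(0) = 0 and π(1) < 1.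
theorem exists_branchingOp_coBall_le_pow {S : Set H} (hS : Subgroup.closure S = ⊤)
    (hρ_one : 1 < ρ) (hπ_zero : π 0 = 0) {K : ℕ} (hK : ∀ g ∈ μ.support, wordLength S g ≤ K)
    {L d : ℕ} (hL : 1 < ρ ^ L * ballProb hμ S L d) :
    ∃ κ : ℝ, 0 < κ ∧ κ < 1 ∧ ∀ s k a : ℕ, K * s + k * d ≤ a →
      (branchingOp hμ π)^[s + k * L] (coBall S a) 1 ≤ κ ^ s := by
  obtain ⟨ε, hε0, hε1, hε⟩ := exists_branchingOp_coBall_le_one_sub hμ hρ hS hρ_one hL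
  obtain ⟨κ, hκ0, hκ1, hκ⟩ := exists_genFun_le_mul hρ hρ_one hπ_zero
    (c := 1 - ε) (by linarith) (by linarith)
  refine ⟨κ, hκ0, hκ1, fun s k a ha => ?_⟩
  rw [Function.iterate_add_apply]
  have h1 := branchingOp_iterate_le hμ π (fun i => {y : H | wordLength S y ≤ K * i})
    (wordLength_mul_step_le hS hK)
    (branchingOp_iterate_mem_Icc hμ π (coBall_mem_Icc S a) (k * L))
    (w' := fun _ => 1 - ε) (fun _ => ⟨by linarith, by linarith⟩) s 0
    (fun y hy => hε k a y (by
      simp only [Set.mem_ofPred_eq, zero_add] at hy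
      omega)) 1 (by simp [wordLength_one])
  refine h1.trans ?_
  rw [branchingOp_iterate_const]
  have h2 : ∀ n, 0 ≤ (genFun π)^[n] (1 - ε) ∧ (genFun π)^[n] (1 - ε) ≤ κ ^ n * (1 - ε) := by
    intro n
    induction n with
    | zero => simp [hε1]
    | succ n ih =>
      have hle : (genFun π)^[n] (1 - ε) ≤ 1 - ε :=
        ih.2.trans (mul_le_of_le_one_left (by linarith) (pow_le_one₀ hκ0.le hκ1.le))
      rw [Function.iterate_succ_apply']
      refine ⟨genFun_nonneg π ih.1, (hκ _ ih.1 hle).trans ?_⟩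
      rw [pow_succ', mul_assoc]
      exact mul_le_mul_of_nonneg_left ih.2 hκ0.le
  exact (h2 s).2.trans (mul_le_of_le_one_right (pow_nonneg hκ0.le s) (by linarith))

end BranchingOperator

/-! ### Decomposition of the tree at the root -/

section Tree

theorem inTree_append_singleton {ξ : List ℕ → ℕ} {v : List ℕ} {k : ℕ} :
    InTree ξ (v ++ [k]) ↔ InTree ξ v ∧ 1 ≤ k ∧ k ≤ ξ v := by
  refine ⟨fun h => ?_, fun h => InTree.child v k h.1 h.2.1 h.2.2⟩
  generalize hw : v ++ [k] = w at h
  cases h with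
  | root => simp at hw
  | child v' k' h1 h2 h3 =>
    obtain ⟨rfl, h⟩ := List.append_inj' hw rfl
    obtain rfl : k = k' := by simpa using h
    exact ⟨h1, h2, h3⟩

theorem inTree_cons {ξ : List ℕ → ℕ} {v : List ℕ} {k : ℕ} :
    InTree ξ (k :: v) ↔ (1 ≤ k ∧ k ≤ ξ []) ∧ InTree (fun w => ξ (k :: w)) v := by
  induction v using List.reverseRecOn with
  | nil =>
    have := inTree_append_singleton (ξ := ξ) (v := []) (k := k)
    simp only [List.nil_append] at this
    rw [this]
    exact ⟨fun h => ⟨h.2, InTree.root⟩, fun h => ⟨InTree.root, h.1⟩⟩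
  | append_singleton v j ih =>
    rw [← List.cons_append, inTree_append_singleton, inTree_append_singleton, ih, and_assoc]

theorem level_zero (ξ : List ℕ → ℕ) : level ξ 0 = {[]} := by
  ext v
  simp only [level, Set.mem_ofPred_eq, List.length_eq_zero_iff, Set.mem_singleton_iff]
  exact ⟨fun h => h.2, fun h => ⟨h ▸ InTree.root, h⟩⟩

theorem cons_mem_level {ξ : List ℕ → ℕ} {n k : ℕ} {v : List ℕ} :
    k :: v ∈ level ξ (n + 1) ↔ (1 ≤ k ∧ k ≤ ξ []) ∧ v ∈ level (fun w => ξ (k :: w)) n := by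
  simp only [level, Set.mem_ofPred_eq, inTree_cons, List.length_cons, Nat.add_right_cancel_iff,
    and_assoc]

theorem forall_mem_level_succ {ξ : List ℕ → ℕ} {n : ℕ} {p : List ℕ → Prop} :
    (∀ v ∈ level ξ (n + 1), p v) ↔
      ∀ k, 1 ≤ k → k ≤ ξ [] → ∀ v ∈ level (fun w => ξ (k :: w)) n, p (k :: v) := by
  refine ⟨fun h k h1 h2 v hv => h _ (cons_mem_level.2 ⟨⟨h1, h2⟩, hv⟩), fun h v hv => ?_⟩
  match v with
  | [] => exact absurd hv.2 (by simp)
  | k :: v =>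
    have := cons_mem_level.1 hv
    exact h k this.1.1 this.1.2 v this.2

theorem level_nonempty {ξ : List ℕ → ℕ} (h : ∀ v, ξ v ≠ 0) (n : ℕ) : (level ξ n).Nonempty := by
  induction n generalizing ξ with
  | zero => rw [level_zero]; exact Set.singleton_nonempty _
  | succ n ih =>
    obtain ⟨v, hv⟩ := ih (ξ := fun w => ξ (1 :: w)) fun w => h _
    exact ⟨1 :: v, cons_mem_level.2 ⟨⟨le_rfl, Nat.one_le_iff_ne_zero.2 (h [])⟩, hv⟩⟩

theorem position_nil {H : Type*} [Group H] (ζ : List ℕ → H) : position ζ [] = 1 := rfl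

theorem position_cons {H : Type*} [Group H] (ζ : List ℕ → H) (k : ℕ) (v : List ℕ) :
    position ζ (k :: v) = ζ [k] * position (fun w => ζ (k :: w)) v := by
  simp only [position, List.length_cons, List.range_succ_eq_map, List.map_cons, List.map_map,
    List.prod_cons]
  rfl

end Tree

/-! ### Events with a countably valued random parameter -/

section Partition

variable {Ω α : Type*} [Countable α] [MeasurableSpace α] [MeasurableSingletonClass α]

theorem setOf_mem_eq_iUnion (X : Ω → α) (E : α → Set Ω) :
    {ω | ω ∈ E (X ω)} = ⋃ a, X ⁻¹' {a} ∩ E a := by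
  ext ω
  simp

theorem measurableSet_setOf_mem {mΩ : MeasurableSpace Ω} {X : Ω → α} (hX : Measurable X)
    {E : α → Set Ω} (hE : ∀ a, MeasurableSet (E a)) : MeasurableSet {ω | ω ∈ E (X ω)} := by
  rw [setOf_mem_eq_iUnion]
  exact MeasurableSet.iUnion fun a => (hX (measurableSet_singleton a)).inter (hE a)

theorem measure_setOf_mem {mΩ : MeasurableSpace Ω} (P : Measure Ω) {X : Ω → α} (hX : Measurable X)
    {E : α → Set Ω} (hE : ∀ a, MeasurableSet (E a)) :
    P {ω | ω ∈ E (X ω)} = ∑' a, P (X ⁻¹' {a} ∩ E a) := by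
  rw [setOf_mem_eq_iUnion, measure_iUnion]
  · intro a b hab
    refine Set.disjoint_left.2 fun ω h1 h2 => hab ?_
    exact (Set.mem_singleton_iff.1 h1.1).symm.trans (Set.mem_singleton_iff.1 h2.1)
  · exact fun a => (hX (measurableSet_singleton a)).inter (hE a)

end Partition

/-! ### Independence of subtrees and avoidance probabilities -/

section Field

variable {H : Type*} [Group H] [MeasurableSpace H]
  {Ω : Type*} [mΩ : MeasurableSpace Ω] {P : Measure Ω}
  {π : PMF ℕ} {μ : PMF H} {ξ : List ℕ → Ω → ℕ} {ζ : List ℕ → Ω → H}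

/-- The σ-algebras generated by the single offspring numbers and the single steps. -/
abbrev coordSigma (ξ : List ℕ → Ω → ℕ) (ζ : List ℕ → Ω → H) :
    List ℕ ⊕ List ℕ → MeasurableSpace Ω
  | .inl v => MeasurableSpace.comap (ξ v) inferInstance
  | .inr v => MeasurableSpace.comap (ζ v) inferInstance

theorem coordSigma_le (hX : IsBranchingRandomWalk P π μ ξ ζ) (i : List ℕ ⊕ List ℕ) :
    coordSigma ξ ζ i ≤ mΩ := by
  match i with
  | .inl v => exact (hX.measurable_offspring v).comap_le
  | .inr v => exact (hX.measurable_step v).comap_le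

/-- A finite intersection splits into an offspring part and a step part. These are independent of
each other, and each factorises within its own family. -/
theorem iIndep_coordSigma (hX : IsBranchingRandomWalk P π μ ξ ζ) :
    iIndep (coordSigma ξ ζ) P := by
  rw [iIndep_iff]
  intro s f hf
  have hl : ∀ v ∈ s.toLeft, MeasurableSet[coordSigma ξ ζ (.inl v)] (f (.inl v)) :=
    fun v hv => hf _ (Finset.mem_toLeft.1 hv)
  have hr : ∀ v ∈ s.toRight, MeasurableSet[coordSigma ξ ζ (.inr v)] (f (.inr v)) :=
    fun v hv => hf _ (Finset.mem_toRight.1 hv)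
  have hsplit : ⋂ i ∈ s, f i
      = (⋂ v ∈ s.toLeft, f (.inl v)) ∩ ⋂ v ∈ s.toRight, f (.inr v) := by
    ext ω
    simp only [Set.mem_iInter, Set.mem_inter_iff, Finset.mem_toLeft, Finset.mem_toRight,
      Sum.forall]
  have hml : MeasurableSet[MeasurableSpace.comap (fun ω v => ξ v ω) inferInstance]
      (⋂ v ∈ s.toLeft, f (.inl v)) := by
    refine Finset.measurableSet_biInter _ fun v hv => ?_
    obtain ⟨t, ht, hft⟩ := hl v hv
    exact ⟨(fun x : List ℕ → ℕ => x v) ⁻¹' t, measurable_pi_apply v ht, hft⟩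
  have hmr : MeasurableSet[MeasurableSpace.comap (fun ω v => ζ v ω) inferInstance]
      (⋂ v ∈ s.toRight, f (.inr v)) := by
    refine Finset.measurableSet_biInter _ fun v hv => ?_
    obtain ⟨t, ht, hft⟩ := hr v hv
    exact ⟨(fun x : List ℕ → H => x v) ⁻¹' t, measurable_pi_apply v ht, hft⟩
  have hprod : ∏ i ∈ s, P (f i)
      = (∏ v ∈ s.toLeft, P (f (.inl v))) * ∏ v ∈ s.toRight, P (f (.inr v)) := by
    rw [← Finset.prod_disjSum s.toLeft s.toRight fun i => P (f i),
      Finset.toLeft_disjSum_toRight]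
  rw [hsplit, hprod,
    (Indep_iff _ _ _).1 ((IndepFun_iff_Indep _ _ _).1 hX.indep_offspring_step) _ _ hml hmr,
    ← (iIndepFun.meas_biInter hX.indep_offspring hl),
    ← (iIndepFun.meas_biInter hX.indep_step hr)]

/-- The σ-algebra generated by a set of coordinates. -/
abbrev fieldSigma (ξ : List ℕ → Ω → ℕ) (ζ : List ℕ → Ω → H) (T : Set (List ℕ ⊕ List ℕ)) :
    MeasurableSpace Ω :=
  ⨆ i ∈ T, coordSigma ξ ζ i

theorem fieldSigma_mono {T T' : Set (List ℕ ⊕ List ℕ)} (h : T ⊆ T') :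
    fieldSigma ξ ζ T ≤ fieldSigma ξ ζ T' :=
  biSup_mono fun _ hi => h hi

theorem fieldSigma_le (hX : IsBranchingRandomWalk P π μ ξ ζ) (T : Set (List ℕ ⊕ List ℕ)) :
    fieldSigma ξ ζ T ≤ mΩ :=
  iSup₂_le fun i _ => coordSigma_le hX i

theorem measure_inter_of_disjoint (hX : IsBranchingRandomWalk P π μ ξ ζ)
    {T T' : Set (List ℕ ⊕ List ℕ)} (hT : Disjoint T T') {A B : Set Ω}
    (hA : MeasurableSet[fieldSigma ξ ζ T] A) (hB : MeasurableSet[fieldSigma ξ ζ T'] B) :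
    P (A ∩ B) = P A * P B :=
  (Indep_iff _ _ _).1
    (indep_iSup_of_disjoint (coordSigma_le hX) (iIndep_coordSigma hX) hT) _ _ hA hB

theorem measurable_offspring_fieldSigma {T : Set (List ℕ ⊕ List ℕ)} {v : List ℕ}
    (hv : .inl v ∈ T) : Measurable[fieldSigma ξ ζ T] (ξ v) :=
  Measurable.mono (comap_measurable (ξ v))
    (le_iSup₂_of_le (f := fun i (_ : i ∈ T) => coordSigma ξ ζ i) (.inl v) hv le_rfl) le_rfl

theorem measurable_step_fieldSigma {T : Set (List ℕ ⊕ List ℕ)} {v : List ℕ}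
    (hv : .inr v ∈ T) : Measurable[fieldSigma ξ ζ T] (ζ v) :=
  Measurable.mono (comap_measurable (ζ v))
    (le_iSup₂_of_le (f := fun i (_ : i ∈ T) => coordSigma ξ ζ i) (.inr v) hv le_rfl) le_rfl

/-- The event that, in the subtree of `u` and starting at `x` in `u`, no particle of relative
generation `n` is in `B`. -/
def avoidEvent (ξ : List ℕ → Ω → ℕ) (ζ : List ℕ → Ω → H) (B : Set H) (n : ℕ) (u : List ℕ)
    (x : H) : Set Ω :=
  {ω | ∀ v ∈ level (fun w => ξ (u ++ w) ω) n, x * position (fun w => ζ (u ++ w) ω) v ∉ B}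

/-- The event that no particle of relative generation `n` in the subtree of `u` is in `B`, when the
parent of `u` is at `x`. -/
def childAvoidEvent (ξ : List ℕ → Ω → ℕ) (ζ : List ℕ → Ω → H) (B : Set H) (n : ℕ) (u : List ℕ)
    (x : H) : Set Ω :=
  {ω | ω ∈ avoidEvent ξ ζ B n u (x * ζ u ω)}

theorem avoidEvent_zero (B : Set H) (u : List ℕ) (x : H) :
    avoidEvent ξ ζ B 0 u x = {_ω | x ∉ B} := by
  ext ω
  simp [avoidEvent, level_zero, position_nil]

theorem avoidEvent_succ (B : Set H) (n : ℕ) (u : List ℕ) (x : H) :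
    avoidEvent ξ ζ B (n + 1) u x
      = {ω | ω ∈ ⋂ k ∈ Finset.Icc 1 (ξ u ω), childAvoidEvent ξ ζ B n (u ++ [k]) x} := by
  ext ω
  simp only [avoidEvent, childAvoidEvent, Set.mem_ofPred_eq, forall_mem_level_succ, position_cons,
    Set.mem_iInter, Finset.mem_Icc, and_imp, List.append_nil, mul_assoc, List.append_assoc,
    List.singleton_append]

/-- The coordinates on which `avoidEvent` depends. -/
def subtreeIndices (u : List ℕ) : Set (List ℕ ⊕ List ℕ) :=
  {i | (∃ w, i = .inl (u ++ w)) ∨ ∃ w, w ≠ [] ∧ i = .inr (u ++ w)}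

/-- The coordinates on which `childAvoidEvent` depends. -/
def childIndices (u : List ℕ) : Set (List ℕ ⊕ List ℕ) :=
  {i | (∃ w, i = .inl (u ++ w)) ∨ ∃ w, i = .inr (u ++ w)}

theorem subtreeIndices_subset (u : List ℕ) : subtreeIndices u ⊆ childIndices u := by
  rintro i (h | ⟨w, -, h⟩)
  exacts [Or.inl h, Or.inr ⟨w, h⟩]

theorem childIndices_subset (u : List ℕ) (k : ℕ) : childIndices (u ++ [k]) ⊆ subtreeIndices u := by
  rintro i (⟨w, rfl⟩ | ⟨w, rfl⟩)
  · exact Or.inl ⟨k :: w, by simp⟩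
  · exact Or.inr ⟨k :: w, by simp, by simp⟩

theorem disjoint_childIndices (u : List ℕ) {j k : ℕ} (hjk : j ≠ k) :
    Disjoint (childIndices (u ++ [j])) (childIndices (u ++ [k])) := by
  refine Set.disjoint_left.2 ?_
  rintro i (⟨w, rfl⟩ | ⟨w, rfl⟩) (⟨w', h⟩ | ⟨w', h⟩) <;> simp at h <;> exact hjk h.1

theorem disjoint_inl_childIndices (u : List ℕ) (k : ℕ) :
    Disjoint {.inl u} (childIndices (u ++ [k])) := by
  rw [Set.disjoint_singleton_left]
  rintro (⟨w', h⟩ | ⟨w', h⟩) <;> simp at h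

theorem disjoint_inr_subtreeIndices (u : List ℕ) :
    Disjoint {.inr u} (subtreeIndices u) := by
  rw [Set.disjoint_singleton_left]
  rintro (⟨w', h⟩ | ⟨w', hw, h⟩) <;> simp_all

variable [Countable H] [DiscreteMeasurableSpace H]

theorem measurableSet_childAvoidEvent {B : Set H} {n : ℕ} {u : List ℕ}
    (h : ∀ x, MeasurableSet[fieldSigma ξ ζ (subtreeIndices u)] (avoidEvent ξ ζ B n u x)) (x : H) :
    MeasurableSet[fieldSigma ξ ζ (childIndices u)] (childAvoidEvent ξ ζ B n u x) :=
  measurableSet_setOf_mem (mΩ := fieldSigma ξ ζ (childIndices u))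
    (measurable_step_fieldSigma (Or.inr ⟨[], by simp⟩))
    fun g => fieldSigma_mono (subtreeIndices_subset u) _ (h (x * g))

theorem measurableSet_avoidEvent (B : Set H) (n : ℕ) (u : List ℕ) (x : H) :
    MeasurableSet[fieldSigma ξ ζ (subtreeIndices u)] (avoidEvent ξ ζ B n u x) := by
  induction n generalizing u x with
  | zero => rw [avoidEvent_zero]; exact MeasurableSet.const _
  | succ n ih =>
    rw [avoidEvent_succ]
    refine measurableSet_setOf_mem (mΩ := fieldSigma ξ ζ (subtreeIndices u)) (X := ξ u)
      (E := fun j => ⋂ k ∈ Finset.Icc 1 j, childAvoidEvent ξ ζ B n (u ++ [k]) x)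
      (measurable_offspring_fieldSigma (Or.inl ⟨[], by simp⟩)) fun j => ?_
    exact Finset.measurableSet_biInter _ fun k _ =>
      fieldSigma_mono (childIndices_subset u k) _ (measurableSet_childAvoidEvent (fun y => ih _ y) x)

theorem measure_step_eq (hX : IsBranchingRandomWalk P π μ ξ ζ) (u : List ℕ) (g : H) :
    P (ζ u ⁻¹' {g}) = μ g := by
  rw [← Measure.map_apply (hX.measurable_step u) (measurableSet_singleton g), hX.law_step,
    PMF.toMeasure_apply_singleton _ _ (measurableSet_singleton g)]

omit [Countable H] [DiscreteMeasurableSpace H] in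
theorem measure_offspring_eq (hX : IsBranchingRandomWalk P π μ ξ ζ) (u : List ℕ) (j : ℕ) :
    P (ξ u ⁻¹' {j}) = π j := by
  rw [← Measure.map_apply (hX.measurable_offspring u) (measurableSet_singleton j),
    hX.law_offspring, PMF.toMeasure_apply_singleton _ _ (measurableSet_singleton j)]

theorem indicator_one_mem_Icc {α : Type*} (B : Set α) (x : α) :
    B.indicator (1 : α → ℝ) x ∈ Set.Icc 0 1 :=
  ⟨Set.indicator_nonneg (fun _ _ => zero_le_one) x,
    Set.indicator_le_self' (fun _ _ => zero_le_one) x⟩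

/-- The probability that generation `n` avoids `B` is an iterate of the branching operator. -/
theorem measure_avoidEvent [IsProbabilityMeasure P] (hμ : μ.support.Finite)
    (hX : IsBranchingRandomWalk P π μ ξ ζ)
    (B : Set H) (n : ℕ) (u : List ℕ) (x : H) :
    P (avoidEvent ξ ζ B n u x)
      = ENNReal.ofReal ((branchingOp hμ π)^[n] (Bᶜ.indicator 1) x) := by
  induction n generalizing u x with
  | zero =>
    rw [avoidEvent_zero]
    by_cases hx : x ∈ B <;> simp [hx]
  | succ n ih =>
    set w := (branchingOp hμ π)^[n] (Bᶜ.indicator 1) with hw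
    have hwI := branchingOp_iterate_mem_Icc hμ π (indicator_one_mem_Icc Bᶜ) n
    have haI := transitionOp_mem_Icc hμ hwI x
    -- The step to the child is independent of the subtree below it, so summing over its values
    -- applies A to w.
    have hchild : ∀ k, P (childAvoidEvent ξ ζ B n (u ++ [k]) x)
        = ENNReal.ofReal (transitionOp hμ w x) := fun k => by
      have h1 := measure_setOf_mem P (hX.measurable_step (u ++ [k]))
        (E := fun g => avoidEvent ξ ζ B n (u ++ [k]) (x * g))
        fun g => fieldSigma_le hX _ _ (measurableSet_avoidEvent B n _ _)
      have h2 := tsum_walkLaw_mul_ofReal hμ (fun y => (hwI y).1) 1 x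
      rw [pow_one, walkLaw_one] at h2
      refine h1.trans ((tsum_congr fun g => ?_).trans h2)
      rw [measure_inter_of_disjoint hX (disjoint_inr_subtreeIndices _)
        (measurable_step_fieldSigma (Set.mem_singleton _) (measurableSet_singleton g))
        (measurableSet_avoidEvent B n _ _), ih, measure_step_eq hX]
    have hmeas : ∀ j, MeasurableSet[fieldSigma ξ ζ (⋃ k ∈ Finset.Icc 1 j, childIndices (u ++ [k]))]
        (⋂ k ∈ Finset.Icc 1 j, childAvoidEvent ξ ζ B n (u ++ [k]) x) := fun j =>
      Finset.measurableSet_biInter _ fun k hk =>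
        fieldSigma_mono (Set.subset_biUnion_of_mem (u := fun k => childIndices (u ++ [k])) hk) _
          (measurableSet_childAvoidEvent (fun y => measurableSet_avoidEvent B n _ y) x)
    -- Distinct children depend on disjoint sets of coordinates. The resulting power j, averaged
    -- over the offspring number of u, is what produces f.
    have hprod : ∀ j, P (⋂ k ∈ Finset.Icc 1 j, childAvoidEvent ξ ζ B n (u ++ [k]) x)
        = ENNReal.ofReal (transitionOp hμ w x) ^ j := fun j => by
      induction j with
      | zero => simp
      | succ j ihj =>
        rw [← Finset.insert_Icc_right_eq_Icc_add_one (by omega), Finset.set_biInter_insert,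
          measure_inter_of_disjoint hX ?_
            (measurableSet_childAvoidEvent (fun y => measurableSet_avoidEvent B n _ y) x) (hmeas j),
          ihj, hchild, pow_succ']
        rw [Set.disjoint_iUnion₂_right]
        intro k hk
        exact disjoint_childIndices u (by have := Finset.mem_Icc.1 hk; omega)
    rw [avoidEvent_succ, measure_setOf_mem P (hX.measurable_offspring u)
      (E := fun j => ⋂ k ∈ Finset.Icc 1 j, childAvoidEvent ξ ζ B n (u ++ [k]) x)
      fun j => fieldSigma_le hX _ _ (hmeas j), Function.iterate_succ_apply', branchingOp, genFun,
      ENNReal.ofReal_tsum_of_nonneg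
        (fun k => mul_nonneg ENNReal.toReal_nonneg (pow_nonneg haI.1 k))
        (summable_genFun π haI.1 haI.2)]
    refine tsum_congr fun j => ?_
    have hdisj : Disjoint {.inl u} (⋃ k ∈ Finset.Icc 1 j, childIndices (u ++ [k])) := by
      rw [Set.disjoint_iUnion₂_right]
      exact fun k _ => disjoint_inl_childIndices u k
    have hroot : MeasurableSet[fieldSigma ξ ζ {.inl u}] (ξ u ⁻¹' {j}) :=
      measurable_offspring_fieldSigma (Set.mem_singleton _) (measurableSet_singleton j)
    have hinter := measure_inter_of_disjoint hX hdisj hroot (hmeas j)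
    rw [hprod, measure_offspring_eq hX] at hinter
    rw [ENNReal.ofReal_mul ENNReal.toReal_nonneg, ENNReal.ofReal_toReal (π.apply_ne_top j),
      ENNReal.ofReal_pow haI.1]
    exact hinter

theorem measure_forall_level_lt [IsProbabilityMeasure P] (hμ : μ.support.Finite)
    (hX : IsBranchingRandomWalk P π μ ξ ζ) (S : Set H) (n a : ℕ) :
    P {ω | ∀ v ∈ level (fun v => ξ v ω) n, a < wordLength S (position (fun v => ζ v ω) v)}
      = ENNReal.ofReal ((branchingOp hμ π)^[n] (coBall S a) 1) := by
  have h := measure_avoidEvent hμ hX {y | wordLength S y ≤ a} n [] 1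
  have h2 : (Set.indicator {y | wordLength S y ≤ a}ᶜ 1 : H → ℝ) = coBall S a := by
    rw [Set.indicator_compl]
    rfl
  rw [h2] at h
  rw [← h]
  simp [avoidEvent]

theorem measurableSet_forall_level_lt (hX : IsBranchingRandomWalk P π μ ξ ζ) (S : Set H)
    (n a : ℕ) :
    MeasurableSet {ω | ∀ v ∈ level (fun v => ξ v ω) n,
      a < wordLength S (position (fun v => ζ v ω) v)} := by
  have h := fieldSigma_le hX _ _
    (measurableSet_avoidEvent (ξ := ξ) (ζ := ζ) {y | wordLength S y ≤ a} n [] 1)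
  simpa [avoidEvent] using h

omit [Countable H] [DiscreteMeasurableSpace H] in
theorem ae_level_nonempty (hX : IsBranchingRandomWalk P π μ ξ ζ) (hπ_zero : π 0 = 0) :
    ∀ᵐ ω ∂P, ∀ n, (level (fun v => ξ v ω) n).Nonempty := by
  have h : ∀ᵐ ω ∂P, ∀ v, ξ v ω ≠ 0 := by
    rw [ae_all_iff]
    intro v
    have := measure_offspring_eq hX v 0
    rw [hπ_zero] at this
    rw [ae_iff]
    simpa [Set.preimage] using this
  filter_upwards [h] with ω hω n
  exact level_nonempty hω n

end Field

/-! ### A supporting line for supermultiplicative families -/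

section Duality

theorem pow_le_of_supermultiplicative {F : ℕ → ℕ → ℝ} (h0 : ∀ n d, 0 ≤ F n d)
    (hmul : ∀ n n' d d', F n d * F n' d' ≤ F (n + n') (d + d')) {n d : ℕ} (p : ℕ) :
    F n d ^ (p + 1) ≤ F ((p + 1) * n) ((p + 1) * d) := by
  induction p with
  | zero => simp
  | succ p ih =>
    rw [pow_succ, add_mul (p + 1) 1 n, add_mul (p + 1) 1 d, one_mul, one_mul]
    exact (mul_le_mul_of_nonneg_right ih (h0 n d)).trans (hmul _ _ _ _)

/-- A supporting line for a two-parameter supermultiplicative family. -/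
theorem exists_le_exp_of_supermultiplicative {F : ℕ → ℕ → ℝ} (h0 : ∀ n d, 0 ≤ F n d)
    (hmul : ∀ n n' d d', F n d * F n' d' ≤ F (n + n') (d + d')) {x : ℝ} (hx : 0 < x)
    {n₀ : ℕ} (hn₀ : 1 ≤ n₀) (hF₀ : 0 < F n₀ 0)
    (h : ∀ n d : ℕ, 1 ≤ n → (d : ℝ) ≤ x * n → F n d ≤ 1) :
    ∃ τ : ℝ, 0 ≤ τ ∧ ∀ n d : ℕ, 1 ≤ n → F n d ≤ Real.exp (τ * (d - x * n)) := by
  -- The slopes τ allowed by points below the line d = xn are those not exceeding any element of A.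
  -- The infimum is taken, and the points above the line must not require more.
  set A : Set ℝ := {t | ∃ n d : ℕ, 1 ≤ n ∧ (d : ℝ) < x * n ∧ 0 < F n d ∧
    t = Real.log (F n d) / (d - x * n)} with hA
  have hA0 : ∀ t ∈ A, 0 ≤ t := by
    rintro t ⟨n, d, hn, hd, hF, rfl⟩
    exact div_nonneg_of_nonpos (Real.log_nonpos hF.le (h n d hn hd.le)) (by linarith)
  have hAne : A.Nonempty := by
    have : (0 : ℝ) < n₀ := by exact_mod_cast hn₀
    exact ⟨_, n₀, 0, hn₀, by push_cast; positivity, hF₀, rfl⟩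
  refine ⟨sInf A, le_csInf hAne hA0, fun n d hn => ?_⟩
  rcases (h0 n d).eq_or_lt with hF | hF
  · rw [← hF]; exact (Real.exp_pos _).le
  rw [← Real.log_le_iff_le_exp hF]
  rcases lt_trichotomy (d : ℝ) (x * n) with hd | hd | hd
  · have := csInf_le ⟨0, hA0⟩ (show _ ∈ A from ⟨n, d, hn, hd, hF, rfl⟩)
    exact (le_div_iff_of_neg (by linarith)).1 this
  · rw [hd, sub_self, mul_zero]
    exact Real.log_nonpos hF.le (h n d hn hd.le)
  · rw [← div_le_iff₀ (by linarith)]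
    refine le_csInf hAne ?_
    rintro t ⟨n', d', hn', hd', hF', rfl⟩
    set e : ℝ := d - x * n with he
    set e' : ℝ := x * n' - d' with he'
    set β := Real.log (F n d) with hβ
    set β' := -Real.log (F n' d') with hβ'
    have hβ'0 : 0 ≤ β' := neg_nonneg.2 (Real.log_nonpos hF'.le (h n' d' hn' hd'.le))
    have he0 : 0 < e := by linarith
    have he'0 : 0 < e' := by linarith
    rw [show (d' : ℝ) - x * n' = -e' by rw [he']; ring,
      show Real.log (F n' d') = -β' by rw [hβ', neg_neg], neg_div_neg_eq]
    by_contra! hlt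
    have hgap : 0 < β - β' * (e / e') := by
      rw [div_lt_div_iff₀ he'0 he0] at hlt
      rw [sub_pos, ← mul_div_assoc, div_lt_iff₀ he'0]
      exact hlt
    -- If a point (n, d) above the line required more than (n', d') allows, then p + 1 copies of the
    -- former and q of the latter would land on or below the line with a product exceeding 1.
    -- Rounding q up costs at most one extra β', which a large p absorbs.
    obtain ⟨p, hp⟩ := exists_nat_gt (β' / (β - β' * (e / e')))
    rw [div_lt_iff₀ hgap] at hp
    have hp' : β' < (p + 1 : ℕ) * (β - β' * (e / e')) := by push_cast; nlinarith
    set q := ⌈((p + 1 : ℕ) : ℝ) * (e / e')⌉₊ with hq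
    have hq1 : ((p + 1 : ℕ) : ℝ) * (e / e') ≤ q := Nat.le_ceil _
    have hq2 : (q : ℝ) < ((p + 1 : ℕ) : ℝ) * (e / e') + 1 := Nat.ceil_lt_add_one (by positivity)
    have hq0 : 0 < q := Nat.ceil_pos.2 (by positivity)
    obtain ⟨q', hq'⟩ : ∃ q', q = q' + 1 := ⟨q - 1, by omega⟩
    have hbig := (mul_le_mul (pow_le_of_supermultiplicative h0 hmul (n := n) (d := d) p)
      (pow_le_of_supermultiplicative h0 hmul (n := n') (d := d') q')
      (pow_nonneg (h0 _ _) _) (h0 _ _)).trans (hmul _ _ _ _)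
    rw [← hq'] at hbig
    have hle1 := hbig.trans (h _ _ (by nlinarith) (by
      push_cast
      have : ((p + 1 : ℕ) : ℝ) * e ≤ q * e' := by
        rw [← mul_div_assoc, div_le_iff₀ he'0] at hq1
        exact hq1
      rw [he, he'] at this
      push_cast at this
      nlinarith))
    have hlog := Real.log_nonpos (by positivity) hle1
    rw [Real.log_mul (pow_pos hF _).ne' (pow_pos hF' _).ne', Real.log_pow, Real.log_pow, ← hβ,
      show Real.log (F n' d') = -β' by rw [hβ', neg_neg]] at hlog
    nlinarith

end Duality

/-! ### Bounds on the limit Λ -/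

section LogMGF

variable {H : Type*} [Group H] {μ : PMF H} (hμ : μ.support.Finite) (S : Set H)

/-- The moment generating function `E[exp (t * |Y n|)]`. -/
noncomputable def lengthMGF (n : ℕ) (t : ℝ) : ℝ :=
  (transitionOp hμ ^ n) (fun y => Real.exp (t * (wordLength S y : ℝ))) 1

/-- Jensen's inequality, through the tangent to the exponential at t times the mean. -/
theorem exp_mul_mean_le_lengthMGF (n : ℕ) (t : ℝ) :
    Real.exp (t * (transitionOp hμ ^ n) (fun y => (wordLength S y : ℝ)) 1) ≤ lengthMGF hμ S n t := by
  set ℓ : H → ℝ := fun y => (wordLength S y : ℝ) with hℓ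
  set a := (transitionOp hμ ^ n) ℓ 1 with ha
  have h := pow_transitionOp_mono hμ (w := fun y => Real.exp (t * a) * (1 - t * a)
      + Real.exp (t * a) * t * ℓ y) (w' := fun y => Real.exp (t * ℓ y)) (fun y => by
    have := Real.add_one_le_exp (t * ℓ y - t * a)
    calc _ = Real.exp (t * a) * (t * ℓ y - t * a + 1) := by ring
      _ ≤ Real.exp (t * a) * Real.exp (t * ℓ y - t * a) :=
        mul_le_mul_of_nonneg_left this (Real.exp_pos _).le
      _ = _ := by rw [← Real.exp_add]; congr 1; ring) n 1
  refine le_trans (le_of_eq ?_) h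
  have h2 := congrFun (map_add (transitionOp hμ ^ n) (fun _ => Real.exp (t * a) * (1 - t * a))
    ((Real.exp (t * a) * t) • ℓ)) 1
  rw [pow_transitionOp_const, map_smul] at h2
  refine Eq.trans ?_ h2.symm
  simp only [Pi.add_apply, Pi.smul_apply, smul_eq_mul, ← ha]
  ring

theorem lengthMGF_pos (n : ℕ) (t : ℝ) : 0 < lengthMGF hμ S n t :=
  (Real.exp_pos _).trans_le (exp_mul_mean_le_lengthMGF hμ S n t)

variable [Countable H] [MeasurableSpace H] [DiscreteMeasurableSpace H]

theorem logMGF_eq (n : ℕ) (t : ℝ) :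
    logMGF S μ n t = Real.log (lengthMGF hμ S n t) / n := by
  rw [logMGF, integral_walkLaw hμ fun _ => (Real.exp_pos _).le, lengthMGF]
  ring

variable {S} (hS : Subgroup.closure S = ⊤)

include hμ hS in
theorem limitLogMGF_le {t B : ℝ} (hB : 0 < B) (C : ℕ)
    (h : ∀ n, 1 ≤ n → lengthMGF hμ S n t ≤ ((C * n + 1 : ℕ) : ℝ) * B ^ n) :
    limitLogMGF S μ t ≤ Real.log B := by
  have h1 : Tendsto (fun n : ℕ => Real.log (C + 1) / n + Real.log n / n + Real.log B) atTop
      (𝓝 (0 + 0 + Real.log B)) := by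
    refine ((tendsto_const_div_atTop_nhds_zero_nat _).add ?_).add tendsto_const_nhds
    have := Real.tendsto_pow_log_div_mul_add_atTop 1 0 1 one_ne_zero
    simp only [pow_one, one_mul, add_zero] at this
    exact this.comp tendsto_natCast_atTop_atTop
  rw [zero_add, zero_add] at h1
  refine le_of_tendsto_of_tendsto (tendsto_logMGF hS μ hμ t) h1 ?_
  filter_upwards [eventually_ge_atTop 1] with n hn
  have hn0 : (0 : ℝ) < n := by exact_mod_cast hn
  have hC : (0 : ℝ) < C + 1 := by positivity
  rw [logMGF_eq hμ, div_le_iff₀ hn0, add_mul, add_mul, div_mul_cancel₀ _ hn0.ne',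
    div_mul_cancel₀ _ hn0.ne', ← Real.log_mul hC.ne' hn0.ne', mul_comm (Real.log B),
    ← Real.log_pow, ← Real.log_mul (by positivity) (by positivity)]
  refine Real.log_le_log (lengthMGF_pos hμ S n t) ((h n hn).trans ?_)
  refine mul_le_mul_of_nonneg_right ?_ (pow_pos hB n).le
  have : (1 : ℝ) ≤ n := by exact_mod_cast hn
  push_cast
  linarith

include hμ hS in
theorem le_limitLogMGF {t B : ℝ} (hB : 0 < B) {n₀ : ℕ} (hn₀ : 1 ≤ n₀)
    (h : ∀ k, 1 ≤ k → B ^ k ≤ lengthMGF hμ S (n₀ * k) t) :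
    Real.log B / n₀ ≤ limitLogMGF S μ t := by
  have hsub : Tendsto (fun k : ℕ => n₀ * k) atTop atTop := tendsto_id.const_mul_atTop' hn₀
  refine ge_of_tendsto ((tendsto_logMGF hS μ hμ t).comp hsub) ?_
  filter_upwards [eventually_ge_atTop 1] with k hk
  have hk0 : (0 : ℝ) < k := by exact_mod_cast hk
  have hn0 : (0 : ℝ) < n₀ := by exact_mod_cast hn₀
  rw [Function.comp_apply, logMGF_eq hμ, div_le_div_iff₀ hn0 (by push_cast; positivity)]
  push_cast
  have := Real.log_le_log (pow_pos hB k) (h k hk)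
  rw [Real.log_pow] at this
  nlinarith

include hμ hS in
theorem limitLogMGF_zero : limitLogMGF S μ 0 = 0 := by
  have h1 : ∀ n, lengthMGF hμ S n 0 = 1 := fun n => by
    have := congrFun (pow_transitionOp_const hμ 1 n) 1
    simpa [lengthMGF] using this
  refine tendsto_nhds_unique (tendsto_logMGF hS μ hμ 0) ?_
  simp only [logMGF_eq hμ, h1, Real.log_one, zero_div]
  exact tendsto_const_nhds

include hμ hS in
theorem limitLogMGF_nonpos {τ : ℝ} (hτ : 0 ≤ τ) : limitLogMGF S μ (-τ) ≤ 0 := by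
  have := limitLogMGF_le hμ hS (t := -τ) one_pos 0 fun n _ => by
    refine (pow_transitionOp_le_one hμ (fun y => ?_) n 1).trans (by simp)
    rw [Real.exp_le_one_iff]
    have : (0 : ℝ) ≤ wordLength S y := Nat.cast_nonneg _
    nlinarith
  rwa [Real.log_one] at this

include hμ hS in
theorem neg_mul_le_limitLogMGF {K : ℕ} (hK : ∀ g ∈ μ.support, wordLength S g ≤ K) {τ : ℝ}
    (hτ : 0 ≤ τ) : -(K * τ) ≤ limitLogMGF S μ (-τ) := by
  have h := le_limitLogMGF hμ hS (t := -τ) (Real.exp_pos (-(K * τ))) le_rfl fun k _ => by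
    have h1 := pow_transitionOp_le hμ (fun i => {y : H | wordLength S y ≤ K * i})
      (wordLength_mul_step_le hS hK) (w := fun _ => Real.exp (-(K * τ)) ^ k)
      (w' := fun y => Real.exp (-τ * (wordLength S y : ℝ))) k 0 (fun y hy => by
        rw [← Real.exp_nat_mul, Real.exp_le_exp]
        have hy' : (wordLength S y : ℝ) ≤ K * k := by
          simp only [Set.mem_ofPred_eq, zero_add] at hy
          exact_mod_cast hy
        nlinarith) 1 (by simp [wordLength_one])
    rw [pow_transitionOp_const] at h1
    rwa [one_mul]
  simpa using h

include hμ hS in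
-- What is needed of the convexity of Λ at 0: Jensen bounds the two logarithms below by t and -τ
-- times the same mean, and these cancel under the weights τ and t.
theorem mul_limitLogMGF_add_nonneg {t τ : ℝ} (ht : 0 ≤ t) (hτ : 0 ≤ τ) :
    0 ≤ τ * limitLogMGF S μ t + t * limitLogMGF S μ (-τ) := by
  refine ge_of_tendsto' (((tendsto_logMGF hS μ hμ t).const_mul τ).add
    ((tendsto_logMGF hS μ hμ (-τ)).const_mul t)) fun n => ?_
  have h1 := (Real.le_log_iff_exp_le (lengthMGF_pos hμ S n t)).2 (exp_mul_mean_le_lengthMGF hμ S n t)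
  have h2 := (Real.le_log_iff_exp_le (lengthMGF_pos hμ S n (-τ))).2
    (exp_mul_mean_le_lengthMGF hμ S n (-τ))
  rw [logMGF_eq hμ, logMGF_eq hμ, ← mul_div_assoc, ← mul_div_assoc, ← add_div]
  refine div_nonneg ?_ (Nat.cast_nonneg n)
  nlinarith [mul_le_mul_of_nonneg_left h1 hτ, mul_le_mul_of_nonneg_left h2 ht]

include hμ hS in
/-- Markov's inequality at exponential scale. -/
theorem ballProb_le_exp_mul_lengthMGF {τ : ℝ} (hτ : 0 ≤ τ) (n d : ℕ) :
    ballProb hμ S n d ≤ Real.exp (τ * d) * lengthMGF hμ S n (-τ) := by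
  have h := pow_transitionOp_mono hμ (w := ballIndicator S d)
    (w' := Real.exp (τ * d) • fun y => Real.exp (-τ * (wordLength S y : ℝ))) (fun y => by
      simp only [Pi.smul_apply, smul_eq_mul, ← Real.exp_add]
      by_cases hy : wordLength S y ≤ d
      · rw [ballIndicator, Set.indicator_of_mem (by simpa using hy), Pi.one_apply, Real.one_le_exp_iff]
        have : (wordLength S y : ℝ) ≤ d := by exact_mod_cast hy
        nlinarith
      · rw [ballIndicator, Set.indicator_of_notMem (by simpa using hy)]
        exact (Real.exp_pos _).le) n 1
  rw [map_smul] at h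
  exact h

include hμ hS in
/-- If balls of radius at most `x * n` have probability at most `ρ ^ (-n)`, then `Λ` is below the
corresponding line at some point of the negative axis. -/
theorem exists_limitLogMGF_le_of_ballProb_le {x ρ : ℝ} (hx : 0 < x) (hρ : 0 < ρ)
    {n₀ : ℕ} (hn₀ : 1 ≤ n₀) (hF₀ : 0 < ballProb hμ S n₀ 0)
    (h : ∀ n d : ℕ, 1 ≤ n → (d : ℝ) ≤ x * n → ρ ^ n * ballProb hμ S n d ≤ 1) :
    ∃ τ : ℝ, 0 ≤ τ ∧ limitLogMGF S μ (-τ) ≤ -Real.log ρ - τ * x := by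
  obtain ⟨τ, hτ, hle⟩ := exists_le_exp_of_supermultiplicative
    (F := fun n d => ρ ^ n * ballProb hμ S n d)
    (fun n d => mul_nonneg (pow_pos hρ n).le (ballProb_nonneg hμ S n d))
    (fun n n' d d' => by
      have := mul_le_mul_of_nonneg_left (ballProb_mul_le hμ hS n n' d d')
        (pow_pos hρ (n + n')).le
      refine le_trans (le_of_eq ?_) this
      rw [pow_add]
      ring) hx hn₀ (mul_pos (pow_pos hρ _) hF₀) h
  obtain ⟨K, hK⟩ := exists_wordLength_le hμ S
  refine ⟨τ, hτ, ?_⟩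
  have hB : 0 < ρ⁻¹ * Real.exp (-(τ * x)) := by positivity
  have hlog : Real.log (ρ⁻¹ * Real.exp (-(τ * x))) = -Real.log ρ - τ * x := by
    rw [Real.log_mul (inv_pos.2 hρ).ne' (Real.exp_pos _).ne', Real.log_inv, Real.log_exp]
    ring
  rw [← hlog]
  refine limitLogMGF_le hμ hS hB K fun n hn => ?_
  -- On |y| ≤ Kn the summand d = |y| alone equals exp(-τ|y|). After A^n, each of the Kn + 1 summands
  -- is at most (ρ⁻¹ exp(-τx))^n, as exp(-τd) cancels against the supporting line.
  have h1 := pow_transitionOp_le hμ (fun i => {y : H | wordLength S y ≤ K * i})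
    (wordLength_mul_step_le hS hK) (w := fun y => Real.exp (-τ * (wordLength S y : ℝ)))
    (w' := ∑ d ∈ Finset.range (K * n + 1), Real.exp (-τ * d) • ballIndicator S d) n 0
    (fun y hy => by
      simp only [Set.mem_ofPred_eq, zero_add] at hy
      rw [Finset.sum_apply]
      refine le_trans (le_of_eq ?_) (Finset.single_le_sum
        (f := fun d : ℕ => (Real.exp (-τ * d) • ballIndicator S d) y)
        (fun d _ => mul_nonneg (Real.exp_pos _).le (ballIndicator_nonneg S d y))
        (Finset.mem_range.2 (Nat.lt_succ_of_le hy)))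
      simp [ballIndicator]) 1 (by simp [wordLength_one])
  refine h1.trans ?_
  simp only [map_sum, map_smul, Finset.sum_apply, Pi.smul_apply, smul_eq_mul]
  refine (Finset.sum_le_card_nsmul _ _ ((ρ⁻¹ * Real.exp (-(τ * x))) ^ n) fun d _ => ?_).trans
    (le_of_eq ?_)
  · have h2 := hle n d hn
    rw [mul_comm, ← le_div_iff₀ (pow_pos hρ n)] at h2
    refine (mul_le_mul_of_nonneg_left h2 (Real.exp_pos _).le).trans (le_of_eq ?_)
    rw [mul_pow, inv_pow, ← Real.exp_nat_mul, ← mul_div_assoc, ← Real.exp_add, div_eq_inv_mul]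
    congr 2
    ring
  · rw [Finset.card_range, nsmul_eq_mul]

end LogMGF

/-! ### The level set of the Legendre transform -/

section Legendre

/-- The Legendre transform of `Λ` attains the level `b` first at the end of the half line cut out by
the negative axis. -/
theorem legendre_level {Λ : ℝ → ℝ} {b K c₀ τ₀ : ℝ} (hb : 0 < b) (hΛ0 : Λ 0 = 0)
    (hΛneg : ∀ τ, 0 < τ → Λ (-τ) ≤ 0) (hΛK : ∀ τ, 0 < τ → -(K * τ) ≤ Λ (-τ))
    (hΛc : ∀ τ, 0 < τ → c₀ ≤ Λ (-τ))
    (hpair : ∀ t τ, 0 < t → 0 < τ → 0 ≤ τ * Λ t + t * Λ (-τ)) (hbτ₀ : b ≤ -Λ (-τ₀)) :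
    ∃ x₀ : ℝ, 0 ≤ x₀ ∧ sInf {x : ℝ | ⨆ t : ℝ, ((x * t - Λ t : ℝ) : EReal) = (b : EReal)} = x₀ ∧
      (∀ x < x₀, ∃ τ, 0 < τ ∧ b < -(τ * x) - Λ (-τ)) ∧
      ∀ τ, 0 < τ → -(τ * x₀) - Λ (-τ) ≤ b := by
  -- Each y in D is the point where the line y' ↦ -τy' - Λ(-τ) crosses the level b. These lines
  -- decrease, so the supremum of D is where the last one falls to b.
  set D : Set ℝ := {y | ∃ τ, 0 < τ ∧ y = -(Λ (-τ) + b) / τ} with hD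
  have hDne : D.Nonempty := ⟨_, 1, one_pos, rfl⟩
  have hDbdd : BddAbove D := by
    refine ⟨K, ?_⟩
    rintro y ⟨τ, hτ, rfl⟩
    rw [div_le_iff₀ hτ]
    linarith [hΛK τ hτ]
  set x₀ := sSup D with hx₀
  have hup : ∀ τ, 0 < τ → -(τ * x₀) - Λ (-τ) ≤ b := fun τ hτ => by
    have := le_csSup hDbdd (show _ ∈ D from ⟨τ, hτ, rfl⟩)
    rw [div_le_iff₀ hτ] at this
    linarith
  have hlow : ∀ x < x₀, ∃ τ, 0 < τ ∧ b < -(τ * x) - Λ (-τ) := fun x hx => by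
    obtain ⟨y, ⟨τ, hτ, rfl⟩, hy⟩ := exists_lt_of_lt_csSup hDne hx
    rw [lt_div_iff₀ hτ] at hy
    exact ⟨τ, hτ, by linarith⟩
  have hx₀0 : 0 ≤ x₀ := by
    by_contra! hneg
    -- With this τ the term -τx₀ is 2b, and Λ(-τ) ≤ 0 then contradicts `hup`.
    have hτ : 0 < 2 * b / -x₀ := div_pos (by linarith) (by linarith)
    have h1 := hup _ hτ
    have h2 := hΛneg _ hτ
    have h3 : 2 * b / -x₀ * x₀ = -(2 * b) := by
      rw [div_neg, neg_mul, div_mul_cancel₀ _ hneg.ne]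
    linarith
  have hle : ⨆ t : ℝ, ((x₀ * t - Λ t : ℝ) : EReal) ≤ (b : EReal) := by
    refine iSup_le fun t => EReal.coe_le_coe_iff.2 ?_
    rcases lt_trichotomy t 0 with ht | rfl | ht
    · have := hup (-t) (by linarith)
      rw [neg_neg] at this
      linarith
    · rw [hΛ0]; linarith
    · have : x₀ ≤ Λ t / t := by
        refine csSup_le hDne ?_
        rintro y ⟨τ, hτ, rfl⟩
        rw [div_le_div_iff₀ hτ ht]
        nlinarith [hpair t τ ht hτ, mul_pos hb ht]
      rw [le_div_iff₀ ht] at this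
      linarith
  have heq : ⨆ t : ℝ, ((x₀ * t - Λ t : ℝ) : EReal) = (b : EReal) := by
    refine le_antisymm hle (le_of_not_gt fun hlt => ?_)
    obtain ⟨c, hc1, hc2⟩ := EReal.lt_iff_exists_real_btwn.1 hlt
    have hc2 : c < b := EReal.coe_lt_coe_iff.1 hc2
    have hc : ∀ τ, -(τ * x₀) - Λ (-τ) ≤ c := fun τ => by
      have h1 := (le_iSup (fun t : ℝ => ((x₀ * t - Λ t : ℝ) : EReal)) (-τ)).trans hc1.le
      have := EReal.coe_le_coe_iff.1 h1
      linarith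
    rcases hx₀0.eq_or_lt with h0 | h0
    · have := hc τ₀
      -- At x₀ = 0 the supremum of D may be approached only as τ → ∞; the assumption on τ₀ is what
      -- attains the level.
      rw [← h0] at this
      linarith
    set M := 2 * |c₀| / x₀ + 1 with hM
    have hM0 : 0 < M := by positivity
    have hlt1 : max (x₀ / 2) (x₀ - (b - c) / M) < x₀ := by
      refine max_lt (by linarith) ?_
      have : 0 < (b - c) / M := div_pos (by linarith) hM0
      linarith
    -- If all lines were at most c < b at x₀ > 0, those with τ ≤ M would cross b at least (b - c)/M
    -- before x₀, and those with τ ≥ M before x₀/2 because Λ(-τ) ≥ c₀. The supremum would be below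
    -- x₀.
    refine absurd (csSup_le hDne ?_) (not_le_of_gt hlt1)
    rintro y ⟨τ, hτ, rfl⟩
    rcases le_total τ M with hτM | hτM
    · refine le_max_of_le_right ?_
      have h1 : -(Λ (-τ) + b) / τ ≤ x₀ - (b - c) / τ := by
        rw [div_le_iff₀ hτ, sub_mul, div_mul_cancel₀ _ hτ.ne']
        linarith [hc τ]
      have h2 : (b - c) / M ≤ (b - c) / τ := by
        gcongr
      linarith
    · refine le_max_of_le_left ?_
      rw [div_le_iff₀ hτ]
      have h1 : 2 * |c₀| ≤ τ * x₀ := by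
        rw [← div_le_iff₀ h0]
        linarith
      linarith [hΛc τ hτ, neg_abs_le c₀]
  refine ⟨x₀, hx₀0, ?_, hlow, hup⟩
  refine IsLeast.csInf_eq ⟨heq, fun x hx => ?_⟩
  by_contra! hlt
  obtain ⟨τ, hτ, h⟩ := hlow x hlt
  have h1 := le_iSup (fun t : ℝ => ((x * t - Λ t : ℝ) : EReal)) (-τ)
  rw [show ⨆ t : ℝ, ((x * t - Λ t : ℝ) : EReal) = (b : EReal) from hx] at h1
  have := EReal.coe_le_coe_iff.1 h1
  linarith

end Legendre

/-! ### Return probabilities and the spectral radius -/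

section Return

variable {H : Type*} [Group H] {μ : PMF H} (hμ : μ.support.Finite)

/-- The probability that the walk started at `y` is at the identity at time `n`. -/
noncomputable def returnProb (n : ℕ) (y : H) : ℝ :=
  (transitionOp hμ ^ n) (Set.indicator {1} 1) y

theorem returnProb_nonneg (n : ℕ) (y : H) : 0 ≤ returnProb hμ n y :=
  pow_transitionOp_nonneg hμ (fun y => (indicator_one_mem_Icc {1} y).1) n y

theorem returnProb_le_one (n : ℕ) (y : H) : returnProb hμ n y ≤ 1 :=
  pow_transitionOp_le_one hμ (fun y => (indicator_one_mem_Icc {1} y).2) n y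

theorem returnProb_zero_one : returnProb hμ 0 (1 : H) = 1 := by
  simp [returnProb]

/-- From xy the walk can first reach x in a steps, undoing y, and then reach the identity in b
steps. -/
theorem returnProb_mul_le (a b : ℕ) (x y : H) :
    returnProb hμ b x * returnProb hμ a y ≤ returnProb hμ (a + b) (x * y) := by
  have h1 : ∀ z, returnProb hμ b x * Set.indicator {1} (1 : H → ℝ) (x⁻¹ * z)
      ≤ (transitionOp hμ ^ b) (Set.indicator {1} 1) z := fun z => by
    by_cases hz : x⁻¹ * z = 1
    · obtain rfl : x = z := by rwa [inv_mul_eq_one] at hz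
      simp [returnProb]
    · rw [Set.indicator_of_notMem (by simpa using hz), mul_zero]
      exact returnProb_nonneg hμ b z
  have h2 := pow_transitionOp_mono hμ h1 a (x * y)
  rw [← Module.End.mul_apply, ← pow_add] at h2
  refine le_trans (le_of_eq ?_) h2
  have h3 := congrFun (map_smul (transitionOp hμ ^ a) (returnProb hμ b x)
    (fun z => Set.indicator {1} (1 : H → ℝ) (x⁻¹ * z))) (x * y)
  refine Eq.trans ?_ h3.symm
  simp only [Pi.smul_apply, smul_eq_mul]
  rw [pow_transitionOp_translate, inv_mul_cancel_left]
  rfl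

/-- The points from which the identity can be reached. -/
def returnSet : Submonoid H where
  carrier := {y | ∃ n, 0 < returnProb hμ n y}
  one_mem' := ⟨0, by rw [returnProb_zero_one]; exact one_pos⟩
  mul_mem' := by
    rintro x y ⟨b, hb⟩ ⟨a, ha⟩
    exact ⟨a + b, (mul_pos hb ha).trans_le (returnProb_mul_le hμ a b x y)⟩

theorem inv_mem_returnSet {g : H} (hg : g ∈ μ.support) : g⁻¹ ∈ returnSet hμ := by
  refine ⟨1, ?_⟩
  rw [returnProb, pow_one, transitionOp_apply]
  refine lt_of_lt_of_le ?_ (Finset.single_le_sum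
    (f := fun k => (μ k).toReal * Set.indicator {1} (1 : H → ℝ) (g⁻¹ * k))
    (fun k _ => mul_nonneg ENNReal.toReal_nonneg (indicator_one_mem_Icc _ _).1)
    (hμ.mem_toFinset.2 hg))
  simpa using ENNReal.toReal_pos hg (μ.apply_ne_top g)

theorem toReal_walkLaw_one_eq (n : ℕ) : (walkLaw μ n 1).toReal = returnProb hμ n 1 :=
  toReal_walkLaw_one hμ n

theorem returnProb_rpow_le_one (n : ℕ) : returnProb hμ n (1 : H) ^ (1 / (n : ℝ)) ≤ 1 :=
  Real.rpow_le_one (returnProb_nonneg hμ n 1) (returnProb_le_one hμ n 1) (by positivity)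

include hμ in
theorem spectralRadius_eq :
    spectralRadius μ = limsup (fun n : ℕ => returnProb hμ n (1 : H) ^ (1 / (n : ℝ))) atTop := by
  simp only [spectralRadius, toReal_walkLaw_one_eq hμ]

theorem isBoundedUnder_returnProb :
    IsBoundedUnder (· ≤ ·) atTop fun n : ℕ => returnProb hμ n (1 : H) ^ (1 / (n : ℝ)) :=
  isBoundedUnder_of ⟨1, returnProb_rpow_le_one hμ⟩

theorem isCoboundedUnder_returnProb :
    IsCoboundedUnder (· ≤ ·) atTop fun n : ℕ => returnProb hμ n (1 : H) ^ (1 / (n : ℝ)) :=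
  IsBoundedUnder.isCoboundedUnder_le
    (isBoundedUnder_of ⟨0, fun n => Real.rpow_nonneg (returnProb_nonneg hμ n 1) _⟩)

include hμ in
theorem spectralRadius_le_one : spectralRadius μ ≤ 1 := by
  rw [spectralRadius_eq hμ]
  exact limsup_le_of_le (isCoboundedUnder_returnProb hμ)
    (Eventually.of_forall (returnProb_rpow_le_one hμ))

theorem returnProb_pow_le (n k : ℕ) :
    returnProb hμ n (1 : H) ^ k ≤ returnProb hμ (n * k) 1 := by
  induction k with
  | zero => simp [returnProb_zero_one]
  | succ k ih =>
    rw [pow_succ, mul_add, mul_one, add_comm (n * k)]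
    have := returnProb_mul_le hμ n (n * k) 1 1
    rw [mul_one] at this
    exact (mul_le_mul_of_nonneg_right ih (returnProb_nonneg hμ n 1)).trans this

/-- By supermultiplicativity the n-th root at time n is a lower bound for the corresponding root at
every multiple of n, hence for the limsup. -/
theorem returnProb_le_spectralRadius_pow {n : ℕ} (hn : 1 ≤ n) :
    returnProb hμ n (1 : H) ≤ spectralRadius μ ^ n := by
  have hp := returnProb_nonneg hμ n (1 : H)
  have hn0 : (0 : ℝ) < n := by exact_mod_cast hn
  have h : returnProb hμ n (1 : H) ^ (1 / (n : ℝ)) ≤ spectralRadius μ := by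
    rw [spectralRadius_eq hμ]
    refine le_limsup_of_frequently_le ?_ (isBoundedUnder_returnProb hμ)
    refine frequently_atTop.2 fun N => ⟨n * (N + 1), by nlinarith, ?_⟩
    have hN : (0 : ℝ) < (N + 1 : ℕ) := by positivity
    have h1 := Real.rpow_le_rpow (pow_nonneg hp _) (returnProb_pow_le hμ n (N + 1))
      (z := 1 / ((n * (N + 1) : ℕ) : ℝ)) (by positivity)
    refine le_trans (le_of_eq ?_) h1
    rw [← Real.rpow_natCast, ← Real.rpow_mul hp]
    congr 1
    push_cast at hN ⊢
    field_simp
  calc returnProb hμ n (1 : H) = (returnProb hμ n (1 : H) ^ (1 / (n : ℝ))) ^ n := by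
        rw [← Real.rpow_natCast, ← Real.rpow_mul hp, one_div_mul_cancel hn0.ne', Real.rpow_one]
    _ ≤ _ := pow_le_pow_left₀ (Real.rpow_nonneg hp _) h n

theorem spectralRadius_pos {n : ℕ} (hn : 1 ≤ n) (h : 0 < returnProb hμ n (1 : H)) :
    0 < spectralRadius μ := by
  rw [spectralRadius_eq hμ]
  have hp : 0 < returnProb hμ n (1 : H) ^ (1 / (n : ℝ)) := Real.rpow_pos_of_pos h _
  refine hp.trans_le (le_limsup_of_frequently_le ?_ (isBoundedUnder_returnProb hμ))
  refine frequently_atTop.2 fun N => ⟨n * (N + 1), by nlinarith, ?_⟩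
  have hn0 : (0 : ℝ) < n := by exact_mod_cast hn
  have h1 := Real.rpow_le_rpow (pow_nonneg h.le _) (returnProb_pow_le hμ n (N + 1))
    (z := 1 / ((n * (N + 1) : ℕ) : ℝ)) (by positivity)
  refine le_trans (le_of_eq ?_) h1
  rw [← Real.rpow_natCast, ← Real.rpow_mul h.le]
  congr 1
  push_cast
  field_simp

theorem exists_one_lt_mul_returnProb {ρ : ℝ} (hρ : 0 < ρ) (h : ρ⁻¹ < spectralRadius μ) :
    ∃ L, 1 ≤ L ∧ 1 < ρ ^ L * returnProb hμ L (1 : H) := by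
  rw [spectralRadius_eq hμ] at h
  have hf := frequently_lt_of_lt_limsup (isCoboundedUnder_returnProb hμ) h
  obtain ⟨L, hL, hlt⟩ := frequently_atTop.1 hf 1
  refine ⟨L, hL, ?_⟩
  have hL0 : (0 : ℝ) < L := by exact_mod_cast hL
  have hp := returnProb_nonneg hμ L (1 : H)
  have h1 := pow_lt_pow_left₀ hlt (inv_pos.2 hρ).le (by omega : L ≠ 0)
  rw [← Real.rpow_natCast (_ ^ _), ← Real.rpow_mul hp, one_div_mul_cancel hL0.ne', Real.rpow_one,
    inv_pow, inv_lt_iff_one_lt_mul₀ (pow_pos hρ L)] at h1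
  linarith

theorem returnProb_one_le_ballProb (S : Set H) (n : ℕ) :
    returnProb hμ n (1 : H) ≤ ballProb hμ S n 0 := by
  refine pow_transitionOp_mono hμ (fun y => ?_) n 1
  by_cases hy : y = 1
  · subst hy; simp [ballIndicator, wordLength_one]
  · rw [Set.indicator_of_notMem (by simpa using hy)]
    exact ballIndicator_nonneg S 0 y

variable [Countable H] [MeasurableSpace H] [DiscreteMeasurableSpace H]
  {S : Set H} (hS : Subgroup.closure S = ⊤)

include hμ hS in
/-- If every reachable point `y` is at time and cost proportional to `|y|` from the identity, then
`Λ` reaches the logarithm of the spectral radius. -/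
theorem limitLogMGF_log_le {C : ℕ} {c : ℝ} (hc0 : 0 < c)
    (hret : ∀ y ∈ Submonoid.closure μ.support,
      ∃ s ≤ C * wordLength S y, c ^ wordLength S y ≤ returnProb hμ s y)
    {n₀ : ℕ} (hn₀ : 1 ≤ n₀) (hpos : 0 < returnProb hμ n₀ (1 : H)) :
    limitLogMGF S μ (Real.log c) ≤ Real.log (spectralRadius μ) := by
  obtain ⟨K, hK⟩ := exists_wordLength_le hμ S
  have hr0 := spectralRadius_pos hμ hn₀ hpos
  have hr1 := spectralRadius_le_one hμ
  refine limitLogMGF_le hμ hS hr0 (C * K) fun n hn => ?_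
  -- For reachable y with |y| ≤ Kn, c^|y| is at most the sum over s ≤ CKn of the probabilities of
  -- returning from y at time s. A^n turns these into return probabilities at times n + s, each at
  -- most r^n.
  have h1 := pow_transitionOp_le hμ
    (fun i => {y : H | wordLength S y ≤ K * i} ∩ Submonoid.closure μ.support)
    (fun i x hx g hg => ⟨wordLength_mul_step_le hS hK i x hx.1 g hg,
      Submonoid.mul_mem _ hx.2 (Submonoid.subset_closure hg)⟩)
    (w := fun y => Real.exp (Real.log c * (wordLength S y : ℝ)))
    (w' := ∑ s ∈ Finset.range (C * K * n + 1),
      (transitionOp hμ ^ s) (Set.indicator {1} 1)) n 0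
    (fun y hy => by
      obtain ⟨hy1, hy2⟩ := hy
      simp only [Set.mem_ofPred_eq, zero_add] at hy1
      obtain ⟨s, hs, hcs⟩ := hret y hy2
      rw [Finset.sum_apply, mul_comm, Real.exp_nat_mul, Real.exp_log hc0]
      refine hcs.trans (Finset.single_le_sum (f := fun s => returnProb hμ s y)
        (fun s _ => returnProb_nonneg hμ s y) (Finset.mem_range.2 ?_))
      have := Nat.mul_le_mul_left C hy1
      rw [mul_assoc]
      omega) 1 ⟨by simp [wordLength_one], Submonoid.one_mem _⟩
  refine h1.trans ?_
  simp only [map_sum, Finset.sum_apply, ← Module.End.mul_apply, ← pow_add]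
  refine (Finset.sum_le_card_nsmul _ _ (spectralRadius μ ^ n) fun s _ => ?_).trans (le_of_eq ?_)
  · exact (returnProb_le_spectralRadius_pow hμ (by omega : 1 ≤ n + s)).trans
      (pow_le_pow_of_le_one hr0.le hr1 (by omega))
  · rw [Finset.card_range, nsmul_eq_mul]

end Return

/-! ### Reduced words under multiplication by a letter -/

section Words

open Monoid.CoprodI

variable {ι : Type*} {G : ι → Type*} [∀ i, Group (G i)] [DecidableEq ι] [∀ i, DecidableEq (G i)]

theorem length_rcons {i : ι} (p : Word.Pair G i) :
    p.tail.toList.length ≤ (Word.rcons p).toList.length ∧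
      (Word.rcons p).toList.length ≤ p.tail.toList.length + 1 := by
  unfold Word.rcons
  split_ifs with h
  · simp
  · simp [Word.cons]

theorem length_of_smul_le {i : ι} (g : G i) (w : Word G) :
    ((of g : Monoid.CoprodI G) • w).toList.length ≤ w.toList.length + 1 := by
  rw [Word.of_smul_def]
  refine (length_rcons _).2.trans (Nat.add_le_add_right ?_ 1)
  refine (length_rcons (Word.equivPair i w)).1.trans (le_of_eq ?_)
  rw [← Word.equivPair_symm, Equiv.symm_apply_apply]

/-- The reduced word of a letter times a word has letters in a submonoid if the two factors do. -/
theorem forall_mem_of_smul {R : Submonoid (Monoid.CoprodI G)} {i : ι} {g : G i}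
    (hg : (of g : Monoid.CoprodI G) ∈ R) {w : Word G}
    (hw : ∀ l ∈ w.toList, (of l.2 : Monoid.CoprodI G) ∈ R) :
    ∀ l ∈ ((of g : Monoid.CoprodI G) • w).toList, (of l.2 : Monoid.CoprodI G) ∈ R := by
  rintro ⟨j, h⟩ hl
  rw [Word.mem_smul_iff] at hl
  rcases hl with ⟨-, hl⟩ | ⟨-, rfl, hl | ⟨m', hm', rfl⟩ | ⟨-, rfl⟩⟩
  · exact hw _ hl
  · exact hw _ (List.mem_of_mem_tail hl)
  · simp only [map_mul]
    exact R.mul_mem hg (hw _ (List.mem_of_mem_head? hm'))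
  · exact hg

end Words

/-! ### Returning to the identity in a free product of finite groups -/

section FreeProductReturn

open Monoid.CoprodI

variable {m : ℕ} {G : Fin m → Type*} [∀ i, Group (G i)] [∀ i, DecidableEq (G i)]

/-- Each edge multiplies by an element of a single factor, which adds at most one letter to the
reduced word. -/
theorem length_word_le_walk_length (S : ∀ i, Set (G i)) {x y : Monoid.CoprodI G}
    (p : (SimpleGraph.mulCayley (generators S)).Walk x y) :
    ((x⁻¹ * y) • (Word.empty : Word G)).toList.length ≤ p.length := by
  induction p with
  | nil => simp [Word.empty]
  | @cons x z y hadj p ih =>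
    rw [SimpleGraph.mulCayley_adj'] at hadj
    obtain ⟨-, s, hs, h⟩ := hadj
    obtain ⟨i, g, hg⟩ : ∃ i, ∃ g : G i, x⁻¹ * z = of g := by
      obtain ⟨i, hi⟩ := Set.mem_iUnion.1 hs
      obtain ⟨g, -, rfl⟩ := hi
      rcases h with h | h
      · exact ⟨i, g, by rw [← h, inv_mul_cancel_left]⟩
      · exact ⟨i, g⁻¹, by rw [h, map_inv, mul_inv_rev, inv_mul_cancel_right]⟩
    rw [show x⁻¹ * y = of g * (z⁻¹ * y) by rw [← hg]; group, mul_smul]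
    exact (length_of_smul_le _ _).trans (Nat.add_le_add_right ih 1)

theorem length_word_le_wordLength {S : ∀ i, Set (G i)} (hS : ∀ i, Subgroup.closure (S i) = ⊤)
    (y : Monoid.CoprodI G) :
    (y • (Word.empty : Word G)).toList.length ≤ wordLength (generators S) y := by
  obtain ⟨p, hp⟩ :=
    (connected_mulCayley (closure_generators hS)).exists_walk_length_eq_dist 1 y
  have := length_word_le_walk_length S p
  rwa [inv_one, one_mul, hp] at this

variable [∀ i, Finite (G i)] (α : PMF (Fin m)) (μ : ∀ i, PMF (G i))

omit [∀ i, DecidableEq (G i)] in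
theorem exists_of_mem_support_stepLaw {g : Monoid.CoprodI G}
    (hg : g ∈ (stepLaw α μ).support) : ∃ i, ∃ h : G i, of h = g := by
  rw [stepLaw, PMF.support_bind] at hg
  obtain ⟨i, -, hi⟩ := Set.mem_iUnion₂.1 hg
  rw [PMF.support_map] at hi
  obtain ⟨h, -, rfl⟩ := hi
  exact ⟨i, h, rfl⟩

omit [∀ i, DecidableEq (G i)] in
-- The inverse of a step h is undone in one step, and h is a power of h⁻¹ because its factor is
-- finite.
theorem mem_returnSet_of_mem_support {g : Monoid.CoprodI G}
    (hg : g ∈ (stepLaw α μ).support) : g ∈ returnSet (finite_support_stepLaw α μ) := by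
  have h1 := inv_mem_returnSet (finite_support_stepLaw α μ) hg
  obtain ⟨i, h, rfl⟩ := exists_of_mem_support_stepLaw α μ hg
  have h2 := (returnSet (finite_support_stepLaw α μ)).pow_mem h1 (orderOf h - 1)
  have h3 : h⁻¹ ^ (orderOf h - 1) = h := by
    rw [inv_pow, inv_eq_iff_mul_eq_one, ← pow_succ,
      Nat.sub_add_cancel (orderOf_pos h), pow_orderOf_eq_one]
  rwa [← map_inv, ← map_pow, h3] at h2

omit [∀ i, DecidableEq (G i)] in
theorem exists_returnProb_one_pos :
    ∃ n, 1 ≤ n ∧ 0 < returnProb (finite_support_stepLaw α μ) n (1 : Monoid.CoprodI G) := by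
  have hμ := finite_support_stepLaw α μ
  obtain ⟨g, hg⟩ := (stepLaw α μ).support_nonempty
  obtain ⟨n, hn⟩ := mem_returnSet_of_mem_support α μ hg
  refine ⟨n + 1, by omega, ?_⟩
  rw [returnProb, pow_succ', Module.End.mul_apply, transitionOp_apply]
  refine lt_of_lt_of_le ?_ (Finset.single_le_sum
    (f := fun k => (stepLaw α μ k).toReal * returnProb hμ n (1 * k))
    (fun k _ => mul_nonneg ENNReal.toReal_nonneg (returnProb_nonneg hμ _ _))
    (hμ.mem_toFinset.2 hg))
  simp only [one_mul]
  exact mul_pos (ENNReal.toReal_pos hg ((stepLaw α μ).apply_ne_top g)) hn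

omit [∀ i, DecidableEq (G i)] in
-- There are only finitely many letters in all, so the return times are bounded and the return
-- probabilities bounded below.
theorem exists_uniform_returnProb :
    ∃ (C : ℕ) (c : ℝ), 0 < c ∧ c < 1 ∧ ∀ i, ∀ h : G i,
      (of h : Monoid.CoprodI G) ∈ returnSet (finite_support_stepLaw α μ) →
        ∃ s ≤ C, c ≤ returnProb (finite_support_stepLaw α μ) s (of h : Monoid.CoprodI G) := by
  set hμ := finite_support_stepLaw α μ
  have hex : ∀ l : (Σ i, G i), ∃ s : ℕ, (of l.2 : Monoid.CoprodI G) ∈ returnSet hμ →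
      0 < returnProb hμ s (of l.2 : Monoid.CoprodI G) := fun l => by
    by_cases hl : (of l.2 : Monoid.CoprodI G) ∈ returnSet hμ
    · obtain ⟨s, hs⟩ := hl
      exact ⟨s, fun _ => hs⟩
    · exact ⟨0, fun h => absurd h hl⟩
  choose s hs using hex
  obtain ⟨C, hC⟩ := (Set.finite_range s).bddAbove
  obtain ⟨M, hM⟩ := (Set.finite_range fun l =>
    (returnProb hμ (s l) (of l.2 : Monoid.CoprodI G))⁻¹).bddAbove
  have hM2 : 1 < max M 2 := lt_of_lt_of_le one_lt_two (le_max_right _ _)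
  refine ⟨C, (max M 2)⁻¹, inv_pos.2 (by linarith), inv_lt_one_of_one_lt₀ hM2, fun i h hh =>
    ⟨s ⟨i, h⟩, hC ⟨_, rfl⟩, ?_⟩⟩
  refine inv_le_of_inv_le₀ (hs ⟨i, h⟩ hh) ((hM ⟨⟨i, h⟩, rfl⟩).trans (le_max_left _ _))

theorem forall_letter_mem_returnSet {y : Monoid.CoprodI G}
    (hy : y ∈ Submonoid.closure (stepLaw α μ).support) :
    ∀ l ∈ (y • (Word.empty : Word G)).toList,
      (of l.2 : Monoid.CoprodI G) ∈ returnSet (finite_support_stepLaw α μ) := by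
  induction hy using Submonoid.closure_induction_left with
  | one => simp [Word.empty]
  | mul_left g hg y _ ih =>
    have hgR := mem_returnSet_of_mem_support α μ hg
    obtain ⟨i, h, rfl⟩ := exists_of_mem_support_stepLaw α μ hg
    rw [mul_smul]
    exact forall_mem_of_smul hgR ih

/-- The letters of the reduced word are undone one after the other; there are at most |y| of them,
and c < 1 allows the exponent to be raised to |y|. -/
theorem exists_returnProb_ge_pow {S : ∀ i, Set (G i)} (hS : ∀ i, Subgroup.closure (S i) = ⊤) :
    ∃ (C : ℕ) (c : ℝ), 0 < c ∧ c < 1 ∧ ∀ y ∈ Submonoid.closure (stepLaw α μ).support,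
      ∃ s ≤ C * wordLength (generators S) y,
        c ^ wordLength (generators S) y ≤ returnProb (finite_support_stepLaw α μ) s y := by
  obtain ⟨C, c, hc0, hc1, hC⟩ := exists_uniform_returnProb α μ
  refine ⟨C, c, hc0, hc1, fun y hy => ?_⟩
  have hlist : ∀ L : List (Σ i, G i), (∀ l ∈ L, (of l.2 : Monoid.CoprodI G) ∈
      returnSet (finite_support_stepLaw α μ)) → ∃ s ≤ C * L.length, c ^ L.length ≤
        returnProb (finite_support_stepLaw α μ) s
          (L.map fun l => (of l.2 : Monoid.CoprodI G)).prod := by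
    intro L
    induction L with
    | nil => exact fun _ => ⟨0, le_rfl, by simp [returnProb_zero_one]⟩
    | cons l L ih =>
      intro hL
      obtain ⟨a, ha, hca⟩ := ih fun l' hl' => hL l' (List.mem_cons_of_mem l hl')
      obtain ⟨b, hb, hcb⟩ := hC l.1 l.2 (hL l List.mem_cons_self)
      refine ⟨a + b, by rw [List.length_cons, mul_add, mul_one]; omega, ?_⟩
      rw [List.map_cons, List.prod_cons, List.length_cons, pow_succ']
      exact (mul_le_mul hcb hca (pow_nonneg hc0.le _) (returnProb_nonneg _ _ _)).trans
        (returnProb_mul_le _ _ _ _ _)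
  obtain ⟨s, hs, hcs⟩ := hlist _ (forall_letter_mem_returnSet α μ hy)
  have hlen := length_word_le_wordLength hS y
  have hprod : ((y • (Word.empty : Word G)).toList.map
      fun l => (of l.2 : Monoid.CoprodI G)).prod = y := by
    have := Word.prod_smul y (Word.empty : Word G)
    rwa [Word.prod_empty, mul_one] at this
  rw [hprod] at hcs
  exact ⟨s, hs.trans (Nat.mul_le_mul_left C hlen),
    (pow_le_pow_of_le_one hc0.le hc1.le hlen).trans hcs⟩

omit [∀ i, DecidableEq (G i)] in
/-- On a free product of finite groups, `Λ` reaches the logarithm of the spectral radius on the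
negative axis. -/
theorem exists_limitLogMGF_le_log_spectralRadius {S : ∀ i, Set (G i)}
    (hS : ∀ i, Subgroup.closure (S i) = ⊤) :
    ∃ τ : ℝ, 0 < τ ∧ limitLogMGF (generators S) (stepLaw α μ) (-τ)
      ≤ Real.log (spectralRadius (stepLaw α μ)) := by
  classical
  obtain ⟨C, c, hc0, hc1, hret⟩ := exists_returnProb_ge_pow α μ hS
  obtain ⟨n₀, hn₀, hpos⟩ := exists_returnProb_one_pos α μ
  refine ⟨-Real.log c, neg_pos.2 (Real.log_neg hc0 hc1), ?_⟩
  rw [neg_neg]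
  exact limitLogMGF_log_le _ (closure_generators hS) hc0 hret hn₀ hpos

end FreeProductReturn

/-! ### Almost sure bounds on the minimal displacement -/

section AlmostSure

/-- The Borel–Cantelli lemma for exponentially small probabilities. -/
theorem ae_eventually_notMem_of_le_pow {Ω : Type*} [MeasurableSpace Ω] {P : Measure Ω}
    {s : ℕ → Set Ω} {q : ℝ} (hq0 : 0 ≤ q) (hq1 : q < 1)
    (h : ∀ᶠ n in atTop, P (s n) ≤ ENNReal.ofReal (q ^ n)) :
    ∀ᵐ ω ∂P, ∀ᶠ n in atTop, ω ∉ s n := by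
  obtain ⟨N, hN⟩ := eventually_atTop.1 h
  have hle : ∀ n, P {ω | N ≤ n ∧ ω ∈ s n} ≤ ENNReal.ofReal (q ^ n) := fun n => by
    by_cases hn : N ≤ n
    · simpa [hn] using hN n hn
    · simp [hn]
  have hsum : ∑' n, P {ω | N ≤ n ∧ ω ∈ s n} ≠ ⊤ := by
    refine ne_top_of_le_ne_top ?_ (ENNReal.tsum_le_tsum hle)
    rw [← ENNReal.ofReal_tsum_of_nonneg (fun n => pow_nonneg hq0 n)
      (summable_geometric_of_lt_one hq0 hq1)]
    exact ENNReal.ofReal_ne_top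
  filter_upwards [ae_eventually_notMem hsum] with ω hω
  filter_upwards [hω, eventually_ge_atTop N] with n hn hNn hmem
  exact hn ⟨hNn, hmem⟩

variable {H : Type*} [Group H] [MeasurableSpace H] [Countable H] [DiscreteMeasurableSpace H]
  {Ω : Type*} [mΩ : MeasurableSpace Ω] {P : Measure Ω} [IsProbabilityMeasure P]
  {π : PMF ℕ} {μ : PMF H} {ξ : List ℕ → Ω → ℕ} {ζ : List ℕ → Ω → H}
  (hμ : μ.support.Finite) {S : Set H} (hS : Subgroup.closure S = ⊤)
  {ρ : ℝ} (hρ : HasSum (fun k : ℕ => (k : ℝ) * (π k).toReal) ρ) (hρ_one : 1 < ρ)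
  (hπ_zero : π 0 = 0) (hX : IsBranchingRandomWalk P π μ ξ ζ)

include hS hρ hρ_one hπ_zero hX in
theorem ae_eventually_minDisplacement_le {L d : ℕ} (hL : 1 ≤ L)
    (h : 1 < ρ ^ L * ballProb hμ S L d) {η : ℝ} (hη : 0 < η) :
    ∀ᵐ ω ∂P, ∀ᶠ n : ℕ in atTop,
      (minDisplacement S (fun v => ξ v ω) (fun v => ζ v ω) n : ℝ) ≤ (d / L + η) * n := by
  obtain ⟨K, hK⟩ := exists_wordLength_le hμ S
  obtain ⟨κ, hκ0, hκ1, hκ⟩ := exists_branchingOp_coBall_le_pow hμ hρ hS hρ_one hπ_zero hK h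
  have hL0 : (0 : ℝ) < L := by exact_mod_cast hL
  -- A fraction δ of the time goes to the initial multiplication. It costs at most Kδn ≤ ηn/2 in
  -- distance, up to a constant, and the other η/2 absorbs the rounding of k.
  set δ : ℝ := min (1 / 2) (η / (2 * (K + 1))) with hδ
  have hδ0 : 0 < δ := lt_min (by norm_num) (by positivity)
  have hδ1 : δ ≤ 1 / 2 := min_le_left _ _
  have hδK : K * δ ≤ η / 2 := by
    have h1 : δ * (2 * (K + 1)) ≤ η := (le_div_iff₀ (by positivity)).1 (min_le_right _ _)
    nlinarith
  set k : ℕ → ℕ := fun n => ⌊(1 - δ) * n / L⌋₊ with hk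
  have hk1 : ∀ n : ℕ, (k n : ℝ) * L ≤ (1 - δ) * n := fun n =>
    (le_div_iff₀ hL0).1 (Nat.floor_le (div_nonneg (mul_nonneg (by linarith) (Nat.cast_nonneg n)) hL0.le))
  have hk2 : ∀ n : ℕ, (1 - δ) * n < ((k n : ℝ) + 1) * L := fun n =>
    (div_lt_iff₀ hL0).1 (Nat.lt_floor_add_one _)
  have hkL : ∀ n, k n * L ≤ n := fun n => by
    have h1 := hk1 n
    have h2 : (0 : ℝ) ≤ δ * n := by positivity
    have : ((k n * L : ℕ) : ℝ) ≤ n := by push_cast; linarith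
    exact_mod_cast this
  set s : ℕ → ℕ := fun n => n - k n * L with hs
  have hsn : ∀ n, s n + k n * L = n := fun n => Nat.sub_add_cancel (hkL n)
  have hsr : ∀ n : ℕ, (s n : ℝ) = n - k n * L := fun n => by
    rw [hs, Nat.cast_sub (hkL n), Nat.cast_mul]
  have hBC := ae_eventually_notMem_of_le_pow (P := P) (q := κ ^ δ)
    (s := fun n => {ω | ∀ v ∈ level (fun v => ξ v ω) n,
      K * s n + k n * d < wordLength S (position (fun v => ζ v ω) v)})
    (Real.rpow_nonneg hκ0.le δ) (Real.rpow_lt_one hκ0.le hκ1 hδ0)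
    (Eventually.of_forall fun n => by
      rw [measure_forall_level_lt hμ hX]
      refine ENNReal.ofReal_le_ofReal ?_
      have h1 := hκ (s n) (k n) _ le_rfl
      rw [hsn] at h1
      refine h1.trans ?_
      rw [← Real.rpow_natCast, ← Real.rpow_natCast, ← Real.rpow_mul hκ0.le]
      refine Real.rpow_le_rpow_of_exponent_ge hκ0 hκ1.le ?_
      rw [hsr]
      linarith [hk1 n])
  filter_upwards [hBC] with ω hω
  have hlarge : ∀ᶠ n : ℕ in atTop, (K : ℝ) * L ≤ η / 2 * n :=
    (tendsto_natCast_atTop_atTop.const_mul_atTop (by positivity)).eventually_ge_atTop _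
  filter_upwards [hω, hlarge] with n hn hnl
  simp only [not_forall, not_lt] at hn
  obtain ⟨v, hv, hle⟩ := hn
  have h1 : minDisplacement S (fun v => ξ v ω) (fun v => ζ v ω) n ≤ K * s n + k n * d := by
    rw [minDisplacement]
    exact (Nat.sInf_le (Set.mem_image_of_mem _ hv)).trans hle
  have h2 : (minDisplacement S (fun v => ξ v ω) (fun v => ζ v ω) n : ℝ) ≤ K * s n + k n * d := by
    exact_mod_cast h1
  refine h2.trans ?_
  have h3 : (k n : ℝ) * d ≤ d / L * n := by
    rw [div_mul_eq_mul_div, le_div_iff₀ hL0]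
    have : (k n : ℝ) * L ≤ n := by exact_mod_cast hkL n
    nlinarith [(Nat.cast_nonneg d : (0 : ℝ) ≤ d)]
  have h4 : (K : ℝ) * s n ≤ K * (δ * n + L) := by
    refine mul_le_mul_of_nonneg_left ?_ (Nat.cast_nonneg K)
    rw [hsr]
    linarith [hk2 n]
  have h5 : K * δ * n ≤ η / 2 * n := mul_le_mul_of_nonneg_right hδK (Nat.cast_nonneg n)
  linarith

include hμ hS hρ hρ_one hπ_zero hX in
theorem ae_eventually_le_minDisplacement {x τ : ℝ} (hτ : 0 ≤ τ)
    (h : Real.log ρ < -(τ * x) - limitLogMGF S μ (-τ)) :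
    ∀ᵐ ω ∂P, ∀ᶠ n : ℕ in atTop,
      x * n ≤ (minDisplacement S (fun v => ξ v ω) (fun v => ζ v ω) n : ℝ) := by
  rcases lt_or_ge x 0 with hx | hx
  · refine Eventually.of_forall fun ω => Eventually.of_forall fun n => ?_
    exact (mul_nonpos_of_nonpos_of_nonneg hx.le (Nat.cast_nonneg n)).trans (Nat.cast_nonneg _)
  have hρ0 : 0 < ρ := by linarith
  obtain ⟨l, hl1, hl2⟩ := exists_between
    (show limitLogMGF S μ (-τ) < -(τ * x) - Real.log ρ by linarith)
  have hq : Real.log ρ + τ * x + l < 0 := by linarith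
  have hBC := ae_eventually_notMem_of_le_pow (P := P) (q := Real.exp (Real.log ρ + τ * x + l))
    (s := fun n => {ω | ∀ v ∈ level (fun v => ξ v ω) n,
      ⌊x * n⌋₊ < wordLength S (position (fun v => ζ v ω) v)}ᶜ)
    (Real.exp_pos _).le (Real.exp_zero ▸ Real.exp_lt_exp.2 hq) (by
      filter_upwards [(tendsto_logMGF hS μ hμ (-τ)).eventually_lt_const hl1,
        eventually_ge_atTop 1] with n hn hn1
      have hn0 : (0 : ℝ) < n := by exact_mod_cast hn1
      rw [prob_compl_eq_one_sub (measurableSet_forall_level_lt hX S n _),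
        measure_forall_level_lt hμ hX, ← ENNReal.ofReal_one,
        ← ENNReal.ofReal_sub _ (branchingOp_iterate_mem_Icc hμ π (coBall_mem_Icc S _) n 1).1]
      refine ENNReal.ofReal_le_ofReal ?_
      have h1 := one_sub_branchingOp_iterate_le hμ hρ hρ0.le (h := ballIndicator S ⌊x * n⌋₊)
        (fun y => ⟨ballIndicator_nonneg _ _ y, ballIndicator_le_one _ _ y⟩) n 1
      refine h1.trans ?_
      have h2 := ballProb_le_exp_mul_lengthMGF hμ hS hτ n ⌊x * n⌋₊
      have h3 : lengthMGF hμ S n (-τ) ≤ Real.exp (l * n) := by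
        rw [logMGF_eq hμ, div_lt_iff₀ hn0] at hn
        exact ((Real.log_lt_iff_lt_exp (lengthMGF_pos hμ S n _)).1 hn).le
      have h4 : Real.exp (τ * ⌊x * n⌋₊) ≤ Real.exp (τ * (x * n)) :=
        Real.exp_le_exp.2 (mul_le_mul_of_nonneg_left (Nat.floor_le (by positivity)) hτ)
      calc ρ ^ n * (transitionOp hμ ^ n) (ballIndicator S ⌊x * n⌋₊) 1
          ≤ ρ ^ n * (Real.exp (τ * (x * n)) * Real.exp (l * n)) := by
            refine mul_le_mul_of_nonneg_left (h2.trans ?_) (pow_pos hρ0 n).le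
            exact mul_le_mul h4 h3 (lengthMGF_pos hμ S n _).le (Real.exp_pos _).le
        _ = _ := by
            rw [← Real.exp_nat_mul, ← Real.exp_log (pow_pos hρ0 n), Real.log_pow,
              ← Real.exp_add, ← Real.exp_add]
            congr 1
            ring)
  filter_upwards [hBC, ae_level_nonempty hX hπ_zero] with ω hω hne
  filter_upwards [hω] with n hn
  simp only [Set.mem_compl_iff, not_not, Set.mem_ofPred_eq] at hn
  -- An empty generation would give `sInf` the value 0, so survival is essential in this direction.
  obtain ⟨v, hv, hveq⟩ := Nat.sInf_mem ((hne n).image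
    fun v => wordLength S (position (fun v => ζ v ω) v))
  have h1 := hn v hv
  have h2 : minDisplacement S (fun v => ξ v ω) (fun v => ζ v ω) n
      = wordLength S (position (fun v => ζ v ω) v) := hveq.symm
  rw [h2]
  exact (Nat.lt_of_floor_lt h1).le

theorem ae_tendsto_div_of_forall {f : Ω → ℕ → ℕ} {v : ℝ}
    (hle : ∀ η : ℝ, 0 < η → ∀ᵐ ω ∂P, ∀ᶠ n : ℕ in atTop, (f ω n : ℝ) ≤ (v + η) * n)
    (hge : ∀ x < v, ∀ᵐ ω ∂P, ∀ᶠ n : ℕ in atTop, x * n ≤ (f ω n : ℝ)) :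
    ∀ᵐ ω ∂P, Tendsto (fun n : ℕ => (f ω n : ℝ) / n) atTop (𝓝 v) := by
  have h1 := ae_all_iff.2 fun j : ℕ => hle (1 / ((j : ℝ) + 1)) (by positivity)
  have h2 := ae_all_iff.2 fun j : ℕ => hge (v - 1 / ((j : ℝ) + 1))
    (sub_lt_self _ (by positivity))
  filter_upwards [h1, h2] with ω hω1 hω2
  rw [tendsto_order]
  constructor
  · intro a ha
    obtain ⟨j, hj⟩ := exists_nat_one_div_lt (sub_pos.2 ha)
    filter_upwards [hω2 j, eventually_gt_atTop 0] with n hn hn0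
    have hn0 : (0 : ℝ) < n := by exact_mod_cast hn0
    rw [lt_div_iff₀ hn0]
    exact lt_of_lt_of_le (mul_lt_mul_of_pos_right (by linarith) hn0) hn
  · intro a ha
    obtain ⟨j, hj⟩ := exists_nat_one_div_lt (sub_pos.2 ha)
    filter_upwards [hω1 j, eventually_gt_atTop 0] with n hn hn0
    have hn0 : (0 : ℝ) < n := by exact_mod_cast hn0
    rw [div_lt_iff₀ hn0]
    exact lt_of_le_of_lt hn (mul_lt_mul_of_pos_right (by linarith) hn0)

include hμ hS in
-- Returns to the identity contribute exp(0) whatever τ is, so Λ is bounded below uniformly on the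
-- negative axis.
theorem log_returnProb_div_le_limitLogMGF {n₀ : ℕ} (hn₀ : 1 ≤ n₀)
    (hpos : 0 < returnProb hμ n₀ (1 : H)) {τ : ℝ} :
    Real.log (returnProb hμ n₀ (1 : H)) / n₀ ≤ limitLogMGF S μ (-τ) := by
  refine le_limitLogMGF hμ hS hpos hn₀ fun k _ => ?_
  refine (returnProb_pow_le hμ n₀ k).trans (pow_transitionOp_mono hμ (fun y => ?_) _ 1)
  by_cases hy : y = 1
  · subst hy; simp [wordLength_one]
  · rw [Set.indicator_of_notMem (by simpa using hy)]
    exact (Real.exp_pos _).le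

end AlmostSure

/-! ### Characterisation of v_min and existence of good blocks -/

section Speed

variable {m : ℕ} {G : Fin m → Type*} [∀ i, Group (G i)] [∀ i, Finite (G i)]
  {S : ∀ i, Set (G i)} (hS : ∀ i, Subgroup.closure (S i) = ⊤)
  (α : PMF (Fin m)) (μ : ∀ i, PMF (G i)) {ρ : ℝ} (hρ_one : 1 < ρ)

include hS hρ_one in
theorem vMin_spec_of_log_le (h : Real.log ρ ≤ -Real.log (spectralRadius (stepLaw α μ))) :
    0 ≤ vMin (generators S) (stepLaw α μ) ρ ∧
      (∀ x < vMin (generators S) (stepLaw α μ) ρ, ∃ τ, 0 < τ ∧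
        Real.log ρ < -(τ * x) - limitLogMGF (generators S) (stepLaw α μ) (-τ)) ∧
      ∀ τ, 0 < τ → -(τ * vMin (generators S) (stepLaw α μ) ρ)
        - limitLogMGF (generators S) (stepLaw α μ) (-τ) ≤ Real.log ρ := by
  have hμ := finite_support_stepLaw α μ
  have hS' := closure_generators hS
  obtain ⟨K, hK⟩ := exists_wordLength_le hμ (generators S)
  obtain ⟨n₀, hn₀, hpos⟩ := exists_returnProb_one_pos α μ
  obtain ⟨τ₀, -, hτ₀⟩ := exists_limitLogMGF_le_log_spectralRadius α μ hS
  obtain ⟨x₀, h0, hx₀, hlow, hup⟩ := legendre_level (Real.log_pos hρ_one)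
    (limitLogMGF_zero hμ hS') (fun τ hτ => limitLogMGF_nonpos hμ hS' hτ.le)
    (fun τ hτ => neg_mul_le_limitLogMGF hμ hS' hK hτ.le)
    (fun τ _ => log_returnProb_div_le_limitLogMGF hμ hS' hn₀ hpos)
    (fun t τ ht hτ => mul_limitLogMGF_add_nonneg hμ hS' ht.le hτ.le) (h.trans (neg_le_neg hτ₀))
  have hv : vMin (generators S) (stepLaw α μ) ρ = x₀ := by
    rw [vMin, if_pos h]
    exact hx₀
  rw [hv]
  exact ⟨h0, hlow, hup⟩

include hS hρ_one in
/-- Above the critical speed, some ball is charged with more than the inverse population size. -/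
theorem exists_one_lt_mul_ballProb {η : ℝ} (hη : 0 < η) :
    ∃ L d : ℕ, 1 ≤ L ∧ (d : ℝ) / L ≤ vMin (generators S) (stepLaw α μ) ρ + η ∧
      1 < ρ ^ L * ballProb (finite_support_stepLaw α μ) (generators S) L d := by
  have hρ0 : 0 < ρ := by linarith
  by_cases h : Real.log ρ ≤ -Real.log (spectralRadius (stepLaw α μ))
  · obtain ⟨hv0, -, hup⟩ := vMin_spec_of_log_le hS α μ hρ_one h
    obtain ⟨n₀, hn₀, hpos⟩ := exists_returnProb_one_pos α μ
    -- Without such a block the duality yields a τ whose line is still at least log ρ at v_min + η.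
    -- For τ > 0 this contradicts its being at most log ρ at v_min, and τ = 0 is excluded by Λ(0) =
    -- 0.
    by_contra! hcon
    obtain ⟨τ, hτ, hle⟩ := exists_limitLogMGF_le_of_ballProb_le (finite_support_stepLaw α μ)
      (closure_generators hS) (x := vMin (generators S) (stepLaw α μ) ρ + η) (by linarith) hρ0 hn₀
      (hpos.trans_le (returnProb_one_le_ballProb _ (generators S) n₀)) fun n d hn hd =>
        hcon n d hn ((div_le_iff₀ (by exact_mod_cast hn)).2 hd)
    rcases hτ.eq_or_lt with rfl | hτ0
    · rw [neg_zero, limitLogMGF_zero (finite_support_stepLaw α μ) (closure_generators hS)] at hle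
      linarith [Real.log_pos hρ_one]
    · nlinarith [hup τ hτ0, mul_pos hτ0 hη]
  · have hr : 0 < spectralRadius (stepLaw α μ) := by
      obtain ⟨n₀, hn₀, hpos⟩ := exists_returnProb_one_pos α μ
      exact spectralRadius_pos _ hn₀ hpos
    have hlt : ρ⁻¹ < spectralRadius (stepLaw α μ) := by
      rw [← Real.log_lt_log_iff (inv_pos.2 hρ0) hr, Real.log_inv]
      linarith
    obtain ⟨L, hL, hL1⟩ := exists_one_lt_mul_returnProb (finite_support_stepLaw α μ) hρ0 hlt
    refine ⟨L, 0, hL, ?_, hL1.trans_le (mul_le_mul_of_nonneg_left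
      (returnProb_one_le_ballProb _ _ L) (pow_pos hρ0 L).le)⟩
    rw [vMin, if_neg h]
    simpa using hη.le

include hS hρ_one in
theorem exists_log_lt_of_lt_vMin {x : ℝ} (hx0 : 0 ≤ x)
    (hx : x < vMin (generators S) (stepLaw α μ) ρ) :
    ∃ τ, 0 < τ ∧ Real.log ρ < -(τ * x) - limitLogMGF (generators S) (stepLaw α μ) (-τ) := by
  by_cases h : Real.log ρ ≤ -Real.log (spectralRadius (stepLaw α μ))
  · exact (vMin_spec_of_log_le hS α μ hρ_one h).2.1 x hx
  · rw [vMin, if_neg h] at hx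
    exact absurd hx hx0.not_gt

end Speed

end FreeProductBRW

theorem theorem1p2 {m : ℕ} (G : Fin m → Type*) [∀ i, Group (G i)] [∀ i, Finite (G i)]
    (S : ∀ i, Set (G i)) (hS_one : ∀ i, 1 ∉ S i) (hS_gen : ∀ i, Subgroup.closure (S i) = ⊤)
    (α : PMF (Fin m)) (μ : ∀ i, PMF (G i)) (hα : ∀ i, 0 < α i)
    (π : PMF ℕ) (ρ : ℝ) (hρ : HasSum (fun k : ℕ => (k : ℝ) * (π k).toReal) ρ) (hρ_one : 1 < ρ)
    (hπ_zero : π 0 = 0)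
    {Ω : Type*} [MeasurableSpace Ω] (P : Measure Ω) [IsProbabilityMeasure P]
    (ξ : List ℕ → Ω → ℕ) (ζ : List ℕ → Ω → Monoid.CoprodI G)
    (hX : IsBranchingRandomWalk P π (stepLaw α μ) ξ ζ) :
    ∀ᵐ ω ∂P, Tendsto
      (fun n : ℕ =>
        (minDisplacement (generators S) (fun v => ξ v ω) (fun v => ζ v ω) n : ℝ) / (n : ℝ))
      atTop (𝓝 (vMin (generators S) (stepLaw α μ) ρ)) := by
  refine ae_tendsto_div_of_forall (fun η hη => ?_) fun x hx => ?_
  -- One half of η is for d/L exceeding v_min, the other for the initial multiplication.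
  · obtain ⟨L, d, hL, hd, h⟩ := exists_one_lt_mul_ballProb hS_gen α μ hρ_one (half_pos hη)
    filter_upwards [ae_eventually_minDisplacement_le (finite_support_stepLaw α μ)
      (closure_generators hS_gen) hρ hρ_one hπ_zero hX hL h (half_pos hη)] with ω hω
    filter_upwards [hω] with n hn
    exact hn.trans (mul_le_mul_of_nonneg_right (by linarith) (Nat.cast_nonneg n))
  · rcases lt_or_ge x 0 with hx0 | hx0
    · refine Eventually.of_forall fun ω => Eventually.of_forall fun n => ?_
      exact (mul_nonpos_of_nonpos_of_nonneg hx0.le (Nat.cast_nonneg n)).trans (Nat.cast_nonneg _)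
    · obtain ⟨τ, hτ, h⟩ := exists_log_lt_of_lt_vMin hS_gen α μ hρ_one hx0 hx
      exact ae_eventually_le_minDisplacement (finite_support_stepLaw α μ)
        (closure_generators hS_gen) hρ hρ_one hπ_zero hX hτ.le h
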